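/- **Exact implementation of energy-conserving unitaries by a clock.** Let $\hbar>0$. Let the engine $e$ be an arbitrary complex Hilbert space with an arbitrary (possibly unbounded) self-adjoint Hamiltonian $H_e$, and let the clock $c$ be $L^2(\mathbb R)$ with Hamiltonian $H_c=P_c=-i\hbar\,\frac{d}{dx}$ (unit velocity). Let $I=[a,a+K]$ with $0\le K<\infty$ be the known interval for the initial clock position, let $L>0$, let $J=[a+K,a+K+L]$ be the interaction region, and put $\tau=K+L$. An *interaction profile* is a bounded measurable family $x\mapsto H^{\rm int}_e(x)$ of bounded self-adjoint operators on $e$, vanishing for $x\notin J$, each commuting with $H_e$. It defines the time-independent interaction $H^{\rm int}=\int_{\mathbb R}H^{\rm int}_e(x)\otimes|x\rangle\langle x|\,dx$ on $e\otimes c$, that is, $(H^{\rm int}\psi)(x)=H^{\rm int}_e(x)\psi(x)$ on $L^2(\mathbb R;e)\cong e\otimes c$. A profile is said to *exactly implement* a unitary $U_e$ on $e$ if the total Hamiltonian $$H=H_e\otimes 1+1\otimes H_c+H^{\rm int},$$ defined as the closure of this operator on the algebraic tensor product of the domains of $H_e$ and $H_c$, is self-adjoint, and for all density operators $\rho_e$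 on $e$ and $\rho_c$ on $c$ such that $\rho_c$ is supported in position in $I$, the state $\rho(t)=e^{-\frac i\hbar Ht}(\rho_e\otimes\rho_c)e^{\frac i\hbar Ht}$ satisfies, for all $t>\tau$, $$\rho(t)=\Big(e^{-\frac i\hbar H_et}\,U_e\,\rho_e\,U_e^\dagger\,e^{\frac i\hbar H_et}\Big)\otimes\Big(e^{-\frac i\hbar H_ct}\,\rho_c\,e^{\frac i\hbar H_ct}\Big).$$ Then: 1. For every unitary $U_e$ on $e$ commuting with $H_e$ there is an interaction profile which exactly implements $U_e$ and for which $U_e=\mathcal T\exp\big(-\frac i\hbar\int_J H^{\rm int}_e(x)\,dx\big)$. The profile does not depend on $\rho_e$ or $\rho_c$. 2. Every interaction profile exactly implements its time-ordered exponential $U_e=\mathcal T\exp\big(-\frac i\hbar\int_J H^{\rm int}_e(x)\,dx\big)$, which is a unitary commuting with $H_e$. 3. The free clock evolution is translation: $(e^{-\frac i\hbar H_ct}f)(x)=f(x-t)$ for all $t\in\mathbb R$ and $f\in L^2(\mathbb R)$. In particular, for $t>\tau$ the clock is uncorrelated with the engine, and its state has only been translated. -/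

import Mathlib

open MeasureTheory Set
open scoped TensorProduct ContDiff ENNReal InnerProductSpace

noncomputable section

/-! ### States and time evolution -/

section General

variable {X : Type*} [NormedAddCommGroup X] [InnerProductSpace ℂ X] [CompleteSpace X]

/-- A density operator: a positive bounded operator with trace one (the trace being computed in a
Hilbert basis; for positive operators it does not depend on the basis). -/
def IsDensityOperator (ρ : X →L[ℂ] X) : Prop :=
  ρ.IsPositive ∧
    ∃ (s : Set X) (b : HilbertBasis s ℂ X), HasSum (fun i => ⟪b i, ρ (b i)⟫_ℂ) 1

/-- `U` is the strongly continuous one-parameter unitary group `t ↦ exp (-(i/ħ) H t)` generated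
by the (possibly unbounded) operator `H`: its derivative at `0` exists exactly on the domain
of `H`, and equals `-(i/ħ) H ψ` there. -/
structure IsEvolution (ħ : ℝ) (H : X →ₗ.[ℂ] X) (U : ℝ → X →L[ℂ] X) : Prop where
  unitary_mem : ∀ t, U t ∈ unitary (X →L[ℂ] X)
  map_zero : U 0 = 1
  map_add : ∀ s t, U (s + t) = U s * U t
  continuous_apply : ∀ ψ, Continuous fun t => U t ψ
  generator : ∀ ψ φ : X, (ψ, φ) ∈ H.graph ↔
    HasDerivAt (fun t => U t ψ) ((-(Complex.I / (ħ : ℂ))) • φ) 0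

open Classical in
/-- The evolution operator `exp (-(i/ħ) H t)`. For self-adjoint `H` the group exists and is unique
by Stone's theorem; the value `0` is used if there is no such group. -/
def evolution (ħ : ℝ) (H : X →ₗ.[ℂ] X) : ℝ → X →L[ℂ] X :=
  if h : ∃ U, IsEvolution ħ H U then h.choose else 0

/-- The bounded operator `A` commutes with the (possibly unbounded) operator `H`, that is,
`A` maps the domain of `H` to itself, and `H A ψ = A H ψ` for `ψ` in the domain of `H`. -/
def CommutesWith (A : X →L[ℂ] X) (H : X →ₗ.[ℂ] X) : Prop :=
  ∀ ψ φ : X, (ψ, φ) ∈ H.graph → (A ψ, A φ) ∈ H.graph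

end General

/-! ### The clock -/

/-- The Hilbert space of the clock, `L²(ℝ)`, in the position representation. -/
abbrev Clock : Type := Lp ℂ 2 (volume : Measure ℝ)

lemma clock_integrable_mul (f : Clock) {φ : ℝ → ℂ} (hc : Continuous φ)
    (hs : HasCompactSupport φ) : Integrable (fun x => f x * φ x) := by
  have h := ((Lp.memLp f).locallyIntegrable (by norm_num)).integrable_smul_left_of_hasCompactSupport
    hc hs
  simpa [mul_comm] using h

/-- The graph of the momentum operator `P = -iħ d/dx`, with the derivative in the weak sense:
`(f, g)` belongs to it if and only if `f, g ∈ L²(ℝ)` and `g = -iħ f'` weakly. -/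
def momentumGraph (ħ : ℝ) : Submodule ℂ (Clock × Clock) where
  carrier := {p | ∀ φ : ℝ → ℂ, ContDiff ℝ ∞ φ → HasCompactSupport φ →
    ∫ x, p.2 x * φ x = Complex.I * (ħ : ℂ) * ∫ x, p.1 x * deriv φ x}
  zero_mem' := by
    intro φ hφ hs
    have h0 : ∀ θ : ℝ → ℂ, ∫ x, (0 : Clock) x * θ x = 0 := fun θ => by
      rw [integral_congr_ae (g := fun _ => (0 : ℂ)), integral_zero]
      filter_upwards [Lp.coeFn_zero ℂ 2 (volume : Measure ℝ)] with x _
      simp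
    simp only [Prod.fst_zero, Prod.snd_zero, h0, mul_zero]
  add_mem' := by
    intro p q hp hq φ hφ hs
    have hd : Continuous (deriv φ) := hφ.continuous_deriv (by simp)
    have hadd : ∀ (f g : Clock) (θ : ℝ → ℂ), Continuous θ → HasCompactSupport θ →
        ∫ x, (f + g) x * θ x = (∫ x, f x * θ x) + ∫ x, g x * θ x := by
      intro f g θ hc hs'
      rw [← integral_add (clock_integrable_mul f hc hs') (clock_integrable_mul g hc hs')]
      refine integral_congr_ae ?_
      filter_upwards [Lp.coeFn_add f g] with x hx
      rw [hx, Pi.add_apply, add_mul]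
    simp only [Prod.fst_add, Prod.snd_add, hadd _ _ _ hφ.continuous hs, hadd _ _ _ hd hs.deriv,
      hp φ hφ hs, hq φ hφ hs, mul_add]
  smul_mem' := by
    intro c p hp φ hφ hs
    have hsmul : ∀ (f : Clock) (θ : ℝ → ℂ),
        ∫ x, (c • f) x * θ x = c * ∫ x, f x * θ x := by
      intro f θ
      rw [← integral_const_mul]
      refine integral_congr_ae ?_
      filter_upwards [Lp.coeFn_smul c f] with x hx
      simp [hx, mul_assoc]
    simp only [Prod.smul_fst, Prod.smul_snd, hsmul, hp φ hφ hs]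
    ring

/-- The momentum operator `P = -iħ d/dx` of the clock, with domain the Sobolev space `H¹(ℝ)`. -/
def momentum (ħ : ℝ) : Clock →ₗ.[ℂ] Clock := (momentumGraph ħ).toLinearPMap

/-- Weak derivatives are unique, so `momentum` is given by its graph. -/
lemma momentum_graph (ħ : ℝ) : (momentum ħ).graph = momentumGraph ħ := by
  refine Submodule.toLinearPMap_graph_eq _ ?_
  rintro ⟨f, g⟩ hp hf
  simp only at hf
  subst hf
  have hloc : LocallyIntegrable (g : ℝ → ℂ) := (Lp.memLp g).locallyIntegrable (by norm_num)
  have key : ∀ᵐ x, (g : ℝ → ℂ) x = 0 := by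
    refine ae_eq_zero_of_integral_contDiff_smul_eq_zero hloc ?_
    intro φ hφ hs
    have h1 := hp (fun x => (φ x : ℂ)) (Complex.ofRealCLM.contDiff.comp hφ)
      (hs.comp_left (g := fun y : ℝ => (y : ℂ)) (by simp))
    have h2 : ∫ x, (0 : Clock) x * deriv (fun x => (φ x : ℂ)) x = 0 := by
      rw [integral_congr_ae (g := fun _ => (0 : ℂ)), integral_zero]
      filter_upwards [Lp.coeFn_zero ℂ 2 (volume : Measure ℝ)] with x _
      simp
    simp only [h2, mul_zero] at h1
    rw [← h1]
    refine integral_congr_ae (Filter.Eventually.of_forall fun x => ?_)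
    simp [mul_comm]
  exact Lp.eq_zero_iff_ae_eq_zero.mpr key

/-- The clock state `ρ` is supported, in position, in the set `I`: all vectors in the range of `ρ`
vanish almost everywhere outside `I`. -/
def PositionSupportedIn (ρ : Clock →L[ℂ] Clock) (I : Set ℝ) : Prop :=
  ∀ f : Clock, ∀ᵐ x, x ∉ I → (ρ f) x = 0

/-! ### Engine and clock together -/

section Joint

variable (E : Type*) [NormedAddCommGroup E] [InnerProductSpace ℂ E]

/-- The Hilbert space `e ⊗ c` of engine and clock: the completed tensor product. -/
abbrev Joint : Type _ := UniformSpace.Completion (E ⊗[ℂ] Clock)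

variable {E}

/-- The product vector `u ⊗ f`. -/
def pureTensor (u : E) (f : Clock) : Joint E := ((u ⊗ₜ[ℂ] f : E ⊗[ℂ] Clock) : Joint E)

/-- The operator `A ⊗ B` on `e ⊗ c`, the continuous extension of `u ⊗ f ↦ A u ⊗ B f`. -/
def tensorOp (A : E →L[ℂ] E) (B : Clock →L[ℂ] Clock) : Joint E →L[ℂ] Joint E :=
  (TensorProduct.mapL A B).completion

lemma tensorOp_pureTensor (A : E →L[ℂ] E) (B : Clock →L[ℂ] Clock) (u : E) (f : Clock) :
    tensorOp A B (pureTensor u f) = pureTensor (A u) (B f) := by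
  simp [tensorOp, pureTensor]

/-- The linear map with `u ⊗ f ↦ (x ↦ f x • u)` from the algebraic tensor product of `E` and
`L²(ℝ)` to `L²(ℝ; E)`. -/
def positionRepAlg : E ⊗[ℂ] Clock →ₗ[ℂ] Lp E 2 (volume : Measure ℝ) :=
  TensorProduct.lift
    { toFun := fun u => ((ContinuousLinearMap.toSpanSingleton ℂ u).compLpL 2 volume).toLinearMap
      map_add' := fun u v => by
        rw [ContinuousLinearMap.toSpanSingleton_add, ContinuousLinearMap.add_compLpL]; rfl
      map_smul' := fun c u => by
        rw [ContinuousLinearMap.toSpanSingleton_smul, ContinuousLinearMap.smul_compLpL]; rfl }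

lemma positionRepAlg_tmul (u : E) (f : Clock) :
    positionRepAlg (u ⊗ₜ[ℂ] f) =ᵐ[volume] fun x => f x • u :=
  (ContinuousLinearMap.toSpanSingleton ℂ u).coeFn_compLpL f

lemma inner_positionRepAlg (ψ φ : E ⊗[ℂ] Clock) :
    ⟪positionRepAlg ψ, positionRepAlg φ⟫_ℂ = ⟪ψ, φ⟫_ℂ := by
  induction ψ with
  | zero => simp
  | add a b ha hb => rw [map_add, inner_add_left, inner_add_left, ha, hb]
  | tmul u f =>
    induction φ with
    | zero => simp
    | add a b ha hb => rw [map_add, inner_add_right, inner_add_right, ha, hb]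
    | tmul v g =>
      rw [TensorProduct.inner_tmul, L2.inner_def, L2.inner_def, ← integral_const_mul]
      refine integral_congr_ae ?_
      filter_upwards [positionRepAlg_tmul u f, positionRepAlg_tmul v g] with x hx hy
      rw [hx, hy, inner_smul_left, inner_smul_right]
      simp only [RCLike.inner_apply]
      ring

variable [CompleteSpace E]

/-- The position representation of the clock on the joint space: the isometry
`e ⊗ c → L²(ℝ; E)` with `u ⊗ f ↦ (x ↦ f x • u)` (it is in fact unitary). -/
def positionRep : Joint E →L[ℂ] Lp E 2 (volume : Measure ℝ) :=
  (positionRepAlg.isometryOfInner inner_positionRepAlg).toContinuousLinearMap.extend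
    (UniformSpace.Completion.toComplL (𝕜 := ℂ) (E := E ⊗[ℂ] Clock))

lemma positionRep_pureTensor (u : E) (f : Clock) :
    positionRep (pureTensor u f) =ᵐ[volume] fun x => f x • u := by
  have h : positionRep (pureTensor u f) = positionRepAlg (u ⊗ₜ[ℂ] f) :=
    ContinuousLinearMap.extend_eq _
      (by exact UniformSpace.Completion.denseRange_coe)
      (by exact UniformSpace.Completion.isUniformInducing_coe _) (u ⊗ₜ[ℂ] f)
  rw [h]
  exact positionRepAlg_tmul u f

/-- An engine interaction profile `x ↦ Hint(x)` with interaction region `S`: an (essentially)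
bounded measurable family of bounded self-adjoint operators on the engine, vanishing
outside `S`, all of which commute with the engine Hamiltonian. -/
structure EngineInteraction (He : E →ₗ.[ℂ] E) (S : Set ℝ) where
  toFun : ℝ → E →L[ℂ] E
  memLp : MemLp toFun ∞ (volume : Measure ℝ)
  selfAdjoint : ∀ x, IsSelfAdjoint (toFun x)
  commutes : ∀ x, CommutesWith (toFun x) He
  support : ∀ x, x ∉ S → toFun x = 0

/-- The interaction Hamiltonian `∫ h(x) ⊗ |x⟩⟨x| dx` on `e ⊗ c`: in the position representation
it is the multiplication operator `(Hint ψ)(x) = h(x) (ψ(x))`. Its matrix elements are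
`⟪ψ, Hint φ⟫ = ∫ ⟪ψ(x), h(x) φ(x)⟫ dx`. -/
def EngineInteraction.op {He : E →ₗ.[ℂ] E} {S : Set ℝ} (h : EngineInteraction He S) :
    Joint E →L[ℂ] Joint E :=
  positionRep.adjoint ∘L
    ((ContinuousLinearMap.id ℂ (E →L[ℂ] E)).holderL volume ∞ 2 2 (h.memLp.toLp h.toFun)) ∘L
    positionRep

/-- The graph of `He ⊗ 1 + 1 ⊗ Hc + Hint` on the algebraic tensor product of the domains of `He`
and `Hc`. -/
def algebraicTotalGraph (He : E →ₗ.[ℂ] E) (Hc : Clock →ₗ.[ℂ] Clock)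
    (Hint : Joint E →L[ℂ] Joint E) : Submodule ℂ (Joint E × Joint E) :=
  Submodule.span ℂ {p | ∃ (u : He.domain) (f : Hc.domain),
    p = (pureTensor (u : E) (f : Clock),
      pureTensor (He u) (f : Clock) + pureTensor (u : E) (Hc f) +
        Hint (pureTensor (u : E) (f : Clock)))}

/-- `H` is the total Hamiltonian `He ⊗ 1 + 1 ⊗ Hc + Hint`: the closure of the operator given by
this expression on the algebraic tensor product of the domains of `He` and `Hc`. -/
def IsTotalHamiltonian (He : E →ₗ.[ℂ] E) (Hc : Clock →ₗ.[ℂ] Clock)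
    (Hint : Joint E →L[ℂ] Joint E) (H : Joint E →ₗ.[ℂ] Joint E) : Prop :=
  H.graph = (algebraicTotalGraph He Hc Hint).topologicalClosure

/-- `W` is the time-ordered exponential `T exp (-(i/ħ) ∫_b^c h(s) ds)` (later times to the left):
`W = Y c`, where `Y` solves `Y' = -(i/ħ) h Y`, `Y b = 1`, in integral form on `[b, c]`. -/
def IsTimeOrderedExp (ħ : ℝ) (h : ℝ → E →L[ℂ] E) (b c : ℝ) (W : E →L[ℂ] E) : Prop :=
  ∃ Y : ℝ → E →L[ℂ] E, ContinuousOn Y (Icc b c) ∧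
    (∀ x ∈ Icc b c, Y x = 1 - (Complex.I / (ħ : ℂ)) • ∫ s in b..x, h s * Y s) ∧ Y c = W

/-- With the interaction `Hint`, the total Hamiltonian `H = He ⊗ 1 + 1 ⊗ P + Hint` is self-adjoint
and the evolution it generates takes every product state, in which the clock is localized
in `I`, at all times `t > τ`, to the product of the engine state
`exp (-(i/ħ) He t) U ρe U† exp ((i/ħ) He t)` and the freely evolved clock state. -/
def ExactlyImplements (ħ : ℝ) (He : E →ₗ.[ℂ] E) (Hint : Joint E →L[ℂ] Joint E) (I : Set ℝ)
    (τ : ℝ) (U : E →L[ℂ] E) : Prop :=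
  ∃ H : Joint E →ₗ.[ℂ] Joint E,
    IsTotalHamiltonian He (momentum ħ) Hint H ∧
    IsSelfAdjoint H ∧
    IsEvolution ħ H (evolution ħ H) ∧
    ∀ (ρe : E →L[ℂ] E) (ρc : Clock →L[ℂ] Clock), IsDensityOperator ρe → IsDensityOperator ρc →
      PositionSupportedIn ρc I → ∀ t : ℝ, τ < t →
        evolution ħ H t * tensorOp ρe ρc * star (evolution ħ H t) =
          tensorOp
            (evolution ħ He t * U * ρe * star U * star (evolution ħ He t))
            (evolution ħ (momentum ħ) t * ρc * star (evolution ħ (momentum ħ) t))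

end Joint

end

/-!
The total Hamiltonian is conjugated into the free one. Let `U t` be the evolution of the engine,
`T t` the translation by `t` on `L²(ℝ)`, and `Y x` the time-ordered exponential of the profile
from the left end of the interaction region up to `x`, so that `Y' = -(i/ħ) h Y`. Let `M` be the
operator on `e ⊗ c` that multiplies by `Y x` in the position representation. It is unitary, and
the *dressed evolution* `W t = M (U t ⊗ T t) M†` is a unitary group. Since `Y x` commutes with
`U t`, one has `(U t ⊗ T t)† W t = Y (x + t) Y(x)†` as a multiplication operator, whose derivative
at `t = 0` is `-(i/ħ) h x`, strongly on the whole space (`hasDerivAt_free_dressed`, by Lebesgue's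
differentiation theorem and dominated convergence, as `h` is only bounded and measurable). Thus
the generator of `W` is exactly the free Hamiltonian plus the interaction
(`mem_generatorGraph_dressed_iff`).

The algebraic tensor product of the domains is a core for the free Hamiltonian, being dense and
invariant under the free evolution (`IsUnitaryGroup.topologicalClosure_eq_generatorGraph`). The
interaction is bounded, so it is also a core for the sum, and the total Hamiltonian is the generator
of `W`; in particular it is self-adjoint. To the left of the interaction region `Y = 1`, and to its
right `Y` is the full time-ordered exponential. A clock state that starts on the left and has
crossed the region by time `t` is therefore translated, while the engine undergoes the full
time-ordered exponential and its own evolution (`dressedEvolution_pureTensor`).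

The evolution of the engine comes from Stone's theorem, proved by Yosida approximation
(`IsSelfAdjoint.exists_isEvolution`); translations are generated by the momentum operator
(`generatorGraph_translation`). The time-ordered exponential is the sum of the Dyson series
(`exists_timeOrdered`), and is unitary (`mem_unitary_of_integral_eq`).

Conversely, a unitary `V` that commutes with the engine Hamiltonian is `exp (i G)` with `G` bounded,
self-adjoint, and commuting with everything that commutes with `V` and `V†`
(`exists_selfAdjoint_exp_eq`); a profile that is a constant multiple of `G` on the interaction
region has `V` as its time-ordered exponential (`exists_engineInteraction`).
-/

noncomputable section

/-! ### Strongly continuous unitary groups and their generators -/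

section UnitaryGroups

open Filter Topology

variable {X : Type*} [NormedAddCommGroup X] [InnerProductSpace ℂ X]

lemma HasDerivAt.continuousLinearMap_apply {Y : Type*} [NormedAddCommGroup Y] [NormedSpace ℂ Y]
    {Z : Type*} [NormedAddCommGroup Z] [NormedSpace ℂ Z] (A : Y →L[ℂ] Z) {g : ℝ → Y} {v : Y} {t : ℝ}
    (h : HasDerivAt g v t) : HasDerivAt (fun s => A (g s)) (A v) t :=
  (A.restrictScalars ℝ).hasFDerivAt.comp_hasDerivAt t h

lemma HasDerivAt.comp_neg_right {g : ℝ → X} {v : X} {t : ℝ} (h : HasDerivAt g v (-t)) :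
    HasDerivAt (fun s => g (-s)) (-v) t := by
  simpa [Function.comp_def] using h.scomp t (hasDerivAt_neg t)

/-- A strongly continuous one-parameter group of unitaries. -/
structure IsUnitaryGroup [CompleteSpace X] (U : ℝ → X →L[ℂ] X) : Prop where
  unitary_mem : ∀ t, U t ∈ unitary (X →L[ℂ] X)
  map_zero : U 0 = 1
  map_add : ∀ s t, U (s + t) = U s * U t
  continuous_apply : ∀ ψ, Continuous fun t => U t ψ

lemma IsEvolution.isUnitaryGroup [CompleteSpace X] {ħ : ℝ} {H : X →ₗ.[ℂ] X} {U : ℝ → X →L[ℂ] X}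
    (h : IsEvolution ħ H U) : IsUnitaryGroup U :=
  ⟨h.unitary_mem, h.map_zero, h.map_add, h.continuous_apply⟩

/-- The graph of the operator `G` with `U t = exp (t c G)`, for a one-parameter group `U`; for
`c = -i/ħ` it is the Hamiltonian. -/
def generatorGraph (c : ℂ) (U : ℝ → X →L[ℂ] X) : Submodule ℂ (X × X) where
  carrier := {p | HasDerivAt (fun t => U t p.1) (c • p.2) 0}
  zero_mem' := by simpa using hasDerivAt_const (0 : ℝ) (0 : X)
  add_mem' := by
    intro p q hp hq
    simpa using HasDerivAt.fun_add hp hq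
  smul_mem' := by
    intro k p hp
    have := HasDerivAt.fun_const_smul k hp
    simpa [smul_comm k c] using this

lemma mem_generatorGraph {c : ℂ} {U : ℝ → X →L[ℂ] X} {p : X × X} :
    p ∈ generatorGraph c U ↔ HasDerivAt (fun t => U t p.1) (c • p.2) 0 := Iff.rfl

/-- Derivatives are unique, so the generator is an operator. -/
lemma toLinearPMap_generatorGraph_graph {c : ℂ} (hc : c ≠ 0) (U : ℝ → X →L[ℂ] X) :
    (generatorGraph c U).toLinearPMap.graph = generatorGraph c U := by
  refine Submodule.toLinearPMap_graph_eq _ ?_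
  rintro ⟨f, g⟩ hp hf
  simp only at hf
  subst hf
  have h1 := mem_generatorGraph.1 hp
  simp only [_root_.map_zero] at h1
  exact (smul_eq_zero.1 (h1.unique (hasDerivAt_const _ _))).resolve_left hc

namespace IsUnitaryGroup

variable [CompleteSpace X]

variable {U : ℝ → X →L[ℂ] X} (hU : IsUnitaryGroup U)
include hU

lemma add_apply (s t : ℝ) (ψ : X) : U (s + t) ψ = U s (U t ψ) := by
  rw [hU.map_add]; rfl

lemma neg_apply_apply (t : ℝ) (ψ : X) : U (-t) (U t ψ) = ψ := by
  rw [← hU.add_apply, neg_add_cancel, hU.map_zero]; rfl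

lemma apply_neg_apply (t : ℝ) (ψ : X) : U t (U (-t) ψ) = ψ := by
  rw [← hU.add_apply, add_neg_cancel, hU.map_zero]; rfl

lemma star_eq (t : ℝ) : star (U t) = U (-t) := by
  have h1 : U t * U (-t) = 1 := by rw [← hU.map_add, add_neg_cancel, hU.map_zero]
  calc star (U t) = star (U t) * (U t * U (-t)) := by rw [h1, mul_one]
    _ = U (-t) := by rw [← mul_assoc, (Unitary.mem_iff.1 (hU.unitary_mem t)).1, one_mul]

lemma inner_apply_left (t : ℝ) (ψ φ : X) : ⟪U t ψ, φ⟫_ℂ = ⟪ψ, U (-t) φ⟫_ℂ := by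
  rw [← hU.star_eq, ContinuousLinearMap.star_eq_adjoint, ContinuousLinearMap.adjoint_inner_right]

lemma norm_apply (t : ℝ) (ψ : X) : ‖U t ψ‖ = ‖ψ‖ := by
  rw [@norm_eq_sqrt_re_inner ℂ, @norm_eq_sqrt_re_inner ℂ _ _ _ _ ψ, hU.inner_apply_left,
    hU.neg_apply_apply]

lemma tendsto_apply {α : Type*} {l : Filter α} {f : α → ℝ} {g : α → X} {t : ℝ} {v : X}
    (hf : Tendsto f l (𝓝 t)) (hg : Tendsto g l (𝓝 v)) :
    Tendsto (fun a => U (f a) (g a)) l (𝓝 (U t v)) := by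
  have h1 : Tendsto (fun a => U (f a) v) l (𝓝 (U t v)) :=
    ((hU.continuous_apply v).tendsto t).comp hf
  have h2 : Tendsto (fun a => U (f a) (g a - v)) l (𝓝 0) := by
    rw [tendsto_zero_iff_norm_tendsto_zero]
    simp only [hU.norm_apply]
    rw [← tendsto_zero_iff_norm_tendsto_zero]
    simpa using hg.sub_const v
  simpa using h2.add h1

lemma hasDerivAt {ψ v : X} (h : HasDerivAt (fun t => U t ψ) v 0) (t : ℝ) :
    HasDerivAt (fun s => U s ψ) (U t v) t := by
  have h1 : HasDerivAt (fun s => U (s - t) ψ) v t := by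
    have h' : HasDerivAt (fun t => U t ψ) v (t - t) := by simpa using h
    exact h'.comp_sub_const t t
  have h2 := h1.continuousLinearMap_apply (U t)
  simpa [← hU.add_apply] using h2

lemma apply_mem_generatorGraph {c : ℂ} {p : X × X} (hp : p ∈ generatorGraph c U) (t : ℝ) :
    (U t p.1, U t p.2) ∈ generatorGraph c U := by
  have h := (mem_generatorGraph.1 hp).continuousLinearMap_apply (U t)
  rw [mem_generatorGraph]
  simpa [← hU.add_apply, add_comm] using h

/-- A derivative in the weak sense, tested against a separating family of functionals, is a
derivative in norm: `U t ψ - ∫ₛ U s v` has constant image under each of the functionals. -/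
lemma hasDerivAt_of_weak {ι : Type*} {ℓ : ι → X →L[ℂ] ℂ} (hℓ : ∀ w, (∀ i, ℓ i w = 0) → w = 0)
    {ψ v : X} (h : ∀ i t, HasDerivAt (fun t => ℓ i (U t ψ)) (ℓ i (U t v)) t) :
    HasDerivAt (fun t => U t ψ) v 0 := by
  have hint : ∀ t, HasDerivAt (fun t => ∫ s in (0 : ℝ)..t, U s v) (U t v) t := fun t =>
    intervalIntegral.integral_hasDerivAt_right ((hU.continuous_apply v).intervalIntegrable _ _)
      (hU.continuous_apply v).stronglyMeasurable.stronglyMeasurableAtFilter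
      (hU.continuous_apply v).continuousAt
  have key : ∀ t, U t ψ = ψ + ∫ s in (0 : ℝ)..t, U s v := by
    intro t
    rw [← sub_eq_zero]
    refine hℓ _ fun i => ?_
    have hd : ∀ t, HasDerivAt (fun t => ℓ i (U t ψ) - ℓ i (∫ s in (0 : ℝ)..t, U s v)) 0 t := by
      intro t
      have := (h i t).fun_sub ((hint t).continuousLinearMap_apply (ℓ i))
      simpa using this
    have hc := is_const_of_deriv_eq_zero (fun t => (hd t).differentiableAt)
      (fun t => (hd t).deriv) t 0
    simp only [hU.map_zero, intervalIntegral.integral_same, one_apply_eq_self,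
      _root_.map_zero, sub_zero] at hc
    rw [map_sub, _root_.map_add, ← hc]
    ring
  have h0 := (hint 0).const_add ψ
  rw [hU.map_zero] at h0
  exact h0.congr_of_eventuallyEq (Eventually.of_forall key)

/-- Averages of an orbit lie in the domain of the generator. -/
lemma hasDerivAt_integral (ε : ℝ) (ψ : X) :
    HasDerivAt (fun t => U t (∫ s in (0 : ℝ)..ε, U s ψ)) (U ε ψ - ψ) 0 := by
  have hc := hU.continuous_apply ψ
  have hi : ∀ a b, IntervalIntegrable (fun s => U s ψ) volume a b := hc.intervalIntegrable
  have hd : ∀ r, HasDerivAt (fun t => ∫ s in (0 : ℝ)..t, U s ψ) (U r ψ) r := fun r =>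
    intervalIntegral.integral_hasDerivAt_right (hi _ _)
      hc.stronglyMeasurable.stronglyMeasurableAtFilter hc.continuousAt
  have h1 : HasDerivAt (fun t => (∫ s in (0 : ℝ)..(t + ε), U s ψ) - ∫ s in (0 : ℝ)..t, U s ψ)
      (U ε ψ - U 0 ψ) 0 := by
    refine HasDerivAt.sub ?_ (hd 0)
    have := hd (0 + ε)
    simpa using this.comp_add_const 0 ε
  rw [hU.map_zero] at h1
  refine h1.congr_of_eventuallyEq (Eventually.of_forall fun t => ?_)
  simp only
  rw [intervalIntegral.integral_interval_sub_left (hi _ _) (hi _ _),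
    ← ContinuousLinearMap.intervalIntegral_comp_comm _ (hi _ _)]
  simp only [← hU.add_apply]
  rw [intervalIntegral.integral_comp_add_left (fun s => U s ψ) t]
  simp [add_comm]

lemma tendsto_average (ψ : X) :
    Tendsto (fun ε : ℝ => ε⁻¹ • ∫ s in (0 : ℝ)..ε, U s ψ) (𝓝[≠] 0) (𝓝 ψ) := by
  have hc := hU.continuous_apply ψ
  have hd : HasDerivAt (fun t => ∫ s in (0 : ℝ)..t, U s ψ) (U 0 ψ) 0 :=
    intervalIntegral.integral_hasDerivAt_right (hc.intervalIntegrable _ _)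
      hc.stronglyMeasurable.stronglyMeasurableAtFilter hc.continuousAt
  rw [hasDerivAt_iff_tendsto_slope, hU.map_zero] at hd
  simpa [slope_fun_def] using hd

/-- Averages of an orbit over short times lie in the domain and converge to its initial point. -/
lemma dense_domain {c : ℂ} (hc : c ≠ 0) : Dense {ψ : X | ∃ φ, (ψ, φ) ∈ generatorGraph c U} := by
  intro ψ
  refine mem_closure_of_tendsto (hU.tendsto_average ψ) (Eventually.of_forall fun ε => ?_)
  refine ⟨c⁻¹ • ε⁻¹ • (U ε ψ - ψ), ?_⟩
  rw [mem_generatorGraph, smul_inv_smul₀ hc]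
  simpa using (hU.hasDerivAt_integral ε ψ).fun_const_smul ε⁻¹

/-- The product rule for `s ↦ U (-s) (g s)`. -/
lemma hasDerivAt_neg_apply {g : ℝ → X} {g' v : X} {t : ℝ} (hg : HasDerivAt g g' t)
    (hv : HasDerivAt (fun s => U s (g t)) v 0) :
    HasDerivAt (fun s => U (-s) (g s)) (U (-t) (g' - v)) t := by
  rw [hasDerivAt_iff_tendsto_slope] at hg ⊢
  have h1 : HasDerivAt (fun s => U (-s) (g t)) (-U (-t) v) t :=
    (hU.hasDerivAt hv (-t)).comp_neg_right
  rw [hasDerivAt_iff_tendsto_slope] at h1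
  have h2 : Tendsto (fun s => U (-s) (slope g t s)) (𝓝[≠] t) (𝓝 (U (-t) g')) :=
    hU.tendsto_apply (tendsto_nhdsWithin_of_tendsto_nhds (continuous_neg.tendsto t)) hg
  rw [map_sub, sub_eq_add_neg]
  refine (h2.add h1).congr fun s => ?_
  have hre : ∀ (r : ℝ) (x : X), U (-s) (r • x) = r • U (-s) x := fun r x =>
    ((U (-s)).restrictScalars ℝ).map_smul r x
  simp only [slope_def_module, hre, map_sub, ← smul_add]
  congr 1
  abel

/-- An operator that maps the generator of `U` into that of `W` intertwines the two groups. -/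
lemma intertwine {W : ℝ → X →L[ℂ] X} (hW : IsUnitaryGroup W) {c : ℂ} (hc : c ≠ 0) {A : X →L[ℂ] X}
    (hA : ∀ ψ φ, (ψ, φ) ∈ generatorGraph c U → (A ψ, A φ) ∈ generatorGraph c W) (t : ℝ) :
    A * U t = W t * A := by
  have key : ∀ ψ φ, (ψ, φ) ∈ generatorGraph c U → A (U t ψ) = W t (A ψ) := by
    intro ψ φ h
    have hd : ∀ s, HasDerivAt (fun s => W (-s) (A (U s ψ))) 0 s := by
      intro s
      have h1 := (hU.hasDerivAt h s).continuousLinearMap_apply A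
      have h2 := hA _ _ (hU.apply_mem_generatorGraph h s)
      have := hW.hasDerivAt_neg_apply h1 h2
      simpa using this
    have hconst := is_const_of_deriv_eq_zero (fun s => (hd s).differentiableAt)
      (fun s => (hd s).deriv) t 0
    simp only [neg_zero, hW.map_zero, hU.map_zero, one_apply_eq_self] at hconst
    rw [← hconst, hW.apply_neg_apply]
  ext ψ
  have := (hU.dense_domain hc).induction (P := fun ψ => (A * U t) ψ = (W t * A) ψ)
    (fun ψ ⟨φ, h⟩ => key ψ φ h)
    (isClosed_eq (A * U t).continuous (W t * A).continuous)
  exact this ψ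

/-- The generator of a unitary group is self-adjoint: a pair that is formally adjoint to the
generator satisfies the differential equation weakly, hence belongs to the generator. -/
lemma mem_generatorGraph_iff_inner {c : ℂ} (hc : c ≠ 0) (hc' : star c = -c) {p : X × X} :
    p ∈ generatorGraph c U ↔ ∀ q ∈ generatorGraph c U, ⟪p.2, q.1⟫_ℂ = ⟪p.1, q.2⟫_ℂ := by
  constructor
  · intro hp q hq
    have h1 := HasDerivAt.inner ℂ (mem_generatorGraph.1 hp) (mem_generatorGraph.1 hq)
    have h2 : (fun t => ⟪U t p.1, U t q.1⟫_ℂ) = fun _ => ⟪p.1, q.1⟫_ℂ := by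
      ext t
      rw [hU.inner_apply_left, hU.neg_apply_apply]
    rw [h2] at h1
    have h3 := h1.unique (hasDerivAt_const _ _)
    simp only [hU.map_zero, one_apply_eq_self, inner_smul_left, inner_smul_right] at h3
    have hc'' : (starRingEnd ℂ) c = -c := hc'
    rw [hc'', neg_mul, ← sub_eq_add_neg, ← mul_sub] at h3
    exact (sub_eq_zero.1 ((mul_eq_zero.1 h3).resolve_left hc)).symm
  · intro hp
    refine hU.hasDerivAt_of_weak (ι := generatorGraph c U) (ℓ := fun q => innerSL ℂ q.1.1) ?_ ?_
    · intro w hw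
      have := (hU.dense_domain hc).induction (P := fun v => ⟪v, w⟫_ℂ = 0)
        (fun v ⟨φ, hφ⟩ => hw ⟨(v, φ), hφ⟩) (isClosed_eq (by fun_prop) (by fun_prop))
      exact inner_self_eq_zero.1 (this w)
    · rintro ⟨q, hq⟩ t
      have h1 : HasDerivAt (fun t => U (-t) q.1) (-U (-t) (c • q.2)) t :=
        (hU.hasDerivAt (mem_generatorGraph.1 hq) (-t)).comp_neg_right
      have h2 := HasDerivAt.inner ℂ h1 (hasDerivAt_const t p.1)
      have h3 := hp _ (hU.apply_mem_generatorGraph hq (-t))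
      have hc'' : (starRingEnd ℂ) c = -c := hc'
      have e1 : ∀ s v, ⟪U (-s) q.1, v⟫_ℂ = ⟪q.1, U s v⟫_ℂ := fun s v => by
        rw [hU.inner_apply_left, neg_neg]
      have h3' : ⟪U (-t) q.2, p.1⟫_ℂ = ⟪U (-t) q.1, p.2⟫_ℂ := by
        rw [← inner_conj_symm, ← h3, inner_conj_symm]
      simp only [e1] at h2
      have h4 : HasDerivAt (fun t => ⟪q.1, U t p.1⟫_ℂ) ⟪q.1, U t (c • p.2)⟫_ℂ t := by
        refine h2.congr_deriv ?_
        simp only [map_smul, _root_.map_zero, inner_neg_left, inner_smul_left, hc'',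
          inner_zero_right, inner_smul_right, zero_add, h3', e1]
        ring
      exact h4

lemma isClosed_generatorGraph {c : ℂ} (hc : c ≠ 0) (hc' : star c = -c) :
    IsClosed (generatorGraph c U : Set (X × X)) := by
  have : (generatorGraph c U : Set (X × X)) =
      ⋂ q ∈ generatorGraph c U, {p | ⟪p.2, q.1⟫_ℂ = ⟪p.1, q.2⟫_ℂ} := by
    ext p
    simpa using hU.mem_generatorGraph_iff_inner hc hc' (p := p)
  rw [this]
  exact isClosed_biInter fun q _ => isClosed_eq (by fun_prop) (by fun_prop)

/-- A dense invariant subspace of the domain of the generator is a core. For `ψ` in the domain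
of `Γ`, the time averages of the orbit of `(ψ, Γ ψ)` belong to the closure of `Γ`; the average
of `Γ ψ` depends continuously on `ψ`, so this extends to all `ψ`. -/
lemma topologicalClosure_eq_generatorGraph {c : ℂ} (hc : c ≠ 0) (hc' : star c = -c)
    {Γ : Submodule ℂ (X × X)} (hle : Γ ≤ generatorGraph c U)
    (hdense : Dense {ψ : X | ∃ φ, (ψ, φ) ∈ Γ})
    (hinv : ∀ t, ∀ p ∈ Γ, (U t p.1, U t p.2) ∈ Γ) :
    Γ.topologicalClosure = generatorGraph c U := by
  refine le_antisymm (Γ.topologicalClosure_minimal hle (hU.isClosed_generatorGraph hc hc')) ?_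
  set K := Γ.topologicalClosure with hK
  have hKc : IsClosed (K : Set (X × X)) := Γ.isClosed_topologicalClosure
  have : CompleteSpace K := hKc.completeSpace_coe
  have hi : ∀ (ψ : X) a b, IntervalIntegrable (fun s => U s ψ) volume a b :=
    fun ψ => (hU.continuous_apply ψ).intervalIntegrable
  have h1 : ∀ (ε : ℝ) (p : X × X), p ∈ Γ →
      (∫ s in (0 : ℝ)..ε, U s p.1, ∫ s in (0 : ℝ)..ε, U s p.2) ∈ K := by
    intro ε p hp
    let F : ℝ → K := fun s => ⟨(U s p.1, U s p.2), Γ.le_topologicalClosure (hinv s p hp)⟩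
    have hF : Continuous F := Continuous.subtype_mk
      ((hU.continuous_apply p.1).prodMk (hU.continuous_apply p.2)) _
    have hFi := hF.intervalIntegrable (μ := volume) 0 ε
    have e1 := ((ContinuousLinearMap.fst ℂ X X).comp K.subtypeL).intervalIntegral_comp_comm hFi
    have e2 := ((ContinuousLinearMap.snd ℂ X X).comp K.subtypeL).intervalIntegral_comp_comm hFi
    have : (∫ s in (0 : ℝ)..ε, U s p.1, ∫ s in (0 : ℝ)..ε, U s p.2) =
        ((∫ s in (0 : ℝ)..ε, F s : K) : X × X) := Prod.ext e1 e2
    rw [this]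
    exact Subtype.mem _
  -- both components depend continuously on `ψ`, so density of the domain of `Γ` suffices
  have h2 : ∀ (ε : ℝ) (ψ : X),
      (∫ s in (0 : ℝ)..ε, U s ψ, c⁻¹ • (U ε ψ - ψ)) ∈ K := by
    intro ε
    have hcont : Continuous fun ψ : X => ∫ s in (0 : ℝ)..ε, U s ψ := by
      let T : X →L[ℂ] X := LinearMap.mkContinuous
        { toFun := fun ψ => ∫ s in (0 : ℝ)..ε, U s ψ
          map_add' := fun ψ φ => by
            simp only [_root_.map_add]
            exact intervalIntegral.integral_add (hi _ _ _) (hi _ _ _)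
          map_smul' := fun k ψ => by
            simp only [map_smul, RingHom.id_apply]
            exact intervalIntegral.integral_smul k _ } |ε - 0| (fun ψ => by
            simp only [LinearMap.coe_mk, AddHom.coe_mk]
            rw [mul_comm]
            exact intervalIntegral.norm_integral_le_of_norm_le_const fun s _ =>
              (hU.norm_apply s ψ).le)
      exact T.continuous
    have := hdense.induction (P := fun ψ => (∫ s in (0 : ℝ)..ε, U s ψ, c⁻¹ • (U ε ψ - ψ)) ∈ K)
      (fun ψ ⟨φ, h⟩ => by
        have e1 : c • ∫ s in (0 : ℝ)..ε, U s φ = U ε ψ - ψ := by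
          have hd : ∀ s, HasDerivAt (fun s => U s ψ) (c • U s φ) s := fun s => by
            simpa using hU.hasDerivAt (hle h) s
          have := intervalIntegral.integral_eq_sub_of_hasDerivAt (a := 0) (b := ε)
            (fun s _ => hd s) (((hU.continuous_apply φ).const_smul c).intervalIntegrable _ _)
          rw [intervalIntegral.integral_smul] at this
          simpa [hU.map_zero] using this
        have := h1 ε _ h
        rwa [← e1, inv_smul_smul₀ hc])
      (hKc.preimage (hcont.prodMk (by fun_prop)))
    exact this
  rintro ⟨ψ, φ⟩ hp
  have h3 : Tendsto (fun ε : ℝ => c⁻¹ • ε⁻¹ • (U ε ψ - ψ)) (𝓝[≠] 0) (𝓝 φ) := by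
    have := mem_generatorGraph.1 hp
    rw [hasDerivAt_iff_tendsto_slope] at this
    have := this.const_smul c⁻¹
    simpa [slope_fun_def, hU.map_zero, inv_smul_smul₀ hc] using this
  refine hKc.mem_of_tendsto ((hU.tendsto_average ψ).prodMk_nhds h3)
    (Eventually.of_forall fun ε => ?_)
  have := (K.restrictScalars ℝ).smul_mem ε⁻¹ (h2 ε ψ)
  simpa [smul_comm c⁻¹] using this

end IsUnitaryGroup

/-- Self-adjointness in terms of the graph, which has to coincide with the set of all pairs that are
formally adjoint to it. -/
lemma LinearPMap.isSelfAdjoint_iff_graph [CompleteSpace X] {H : X →ₗ.[ℂ] X}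
    (hd : Dense (H.domain : Set X)) :
    IsSelfAdjoint H ↔
      ∀ p : X × X, p ∈ H.graph ↔ ∀ q ∈ H.graph, ⟪p.2, q.1⟫_ℂ = ⟪p.1, q.2⟫_ℂ := by
  have h1 : ∀ p : X × X, p ∈ (LinearPMap.adjoint H).graph ↔
      ∀ q ∈ H.graph, ⟪p.2, q.1⟫_ℂ = ⟪p.1, q.2⟫_ℂ := by
    intro p
    rw [LinearPMap.adjoint_graph_eq_graph_adjoint hd, Submodule.mem_adjoint_iff]
    constructor
    · intro h q hq
      have := h q.1 q.2 hq
      rw [← inner_conj_symm, ← inner_conj_symm p.1, sub_eq_zero.1 this]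
    · intro h a b hab
      have := h _ hab
      rw [sub_eq_zero, ← inner_conj_symm, ← inner_conj_symm a, this]
  rw [LinearPMap.isSelfAdjoint_def]
  constructor
  · intro h p
    rw [← h1, h]
  · intro h
    refine LinearPMap.eq_of_eq_graph ?_
    ext p
    rw [h1, h]

end UnitaryGroups

/-! ### Stone's theorem -/

section Stone

open Filter Topology

variable {X : Type*} [NormedAddCommGroup X] [InnerProductSpace ℂ X]

/-- Strong convergence of uniformly bounded operators has to be checked on a dense set only. -/
lemma tendsto_apply_of_dense {α Y : Type*} [NormedAddCommGroup Y] [NormedSpace ℂ Y] {l : Filter α}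
    {T : α → X →L[ℂ] Y} {A : X →L[ℂ] Y} {C : ℝ} (hT : ∀ a ψ, ‖T a ψ‖ ≤ C * ‖ψ‖) {s : Set X}
    (hs : Dense s) (h : ∀ ψ ∈ s, Tendsto (fun a => T a ψ) l (𝓝 (A ψ))) (ψ : X) :
    Tendsto (fun a => T a ψ) l (𝓝 (A ψ)) := by
  rw [Metric.tendsto_nhds]
  intro ε hε
  set K := max C 0 + ‖A‖ + 1 with hK
  have hK0 : 0 < K := by positivity
  obtain ⟨χ, hχ, hd⟩ := hs.exists_dist_lt ψ (show 0 < ε / 2 / K by positivity)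
  filter_upwards [(Metric.tendsto_nhds.1 (h χ hχ)) (ε / 2) (by positivity)] with a ha
  rw [dist_eq_norm] at hd ha ⊢
  have e : T a ψ - A ψ = (T a (ψ - χ) - A (ψ - χ)) + (T a χ - A χ) := by
    simp only [map_sub]; abel
  have h1 : ‖T a (ψ - χ) - A (ψ - χ)‖ ≤ K * ‖ψ - χ‖ := by
    calc _ ≤ ‖T a (ψ - χ)‖ + ‖A (ψ - χ)‖ := norm_sub_le _ _
      _ ≤ C * ‖ψ - χ‖ + ‖A‖ * ‖ψ - χ‖ := add_le_add (hT _ _) (A.le_opNorm _)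
      _ ≤ K * ‖ψ - χ‖ := by
        rw [← add_mul]
        gcongr
        linarith [le_max_left C 0]
  have h2 : K * ‖ψ - χ‖ < ε / 2 := by
    rw [lt_div_iff₀ hK0] at hd
    linarith
  rw [e]
  linarith [norm_add_le (T a (ψ - χ) - A (ψ - χ)) (T a χ - A χ)]

variable [CompleteSpace X]

/-- A one-parameter group with `U(t)† = U (-t)` is unitary. -/
lemma IsUnitaryGroup.of_inner {U : ℝ → X →L[ℂ] X} (h0 : U 0 = 1)
    (hadd : ∀ s t, U (s + t) = U s * U t) (hinner : ∀ t ψ φ, ⟪U t ψ, φ⟫_ℂ = ⟪ψ, U (-t) φ⟫_ℂ)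
    (hcont : ∀ ψ, Continuous fun t => U t ψ) : IsUnitaryGroup U := by
  refine ⟨fun t => ?_, h0, hadd, hcont⟩
  have hs : star (U t) = U (-t) := by
    rw [ContinuousLinearMap.star_eq_adjoint, eq_comm, ContinuousLinearMap.eq_adjoint_iff]
    intro ψ φ
    rw [hinner, neg_neg]
  rw [Unitary.mem_iff, hs, ← hadd, ← hadd, neg_add_cancel, add_neg_cancel]
  exact ⟨h0, h0⟩

lemma star_neg_I_div (ħ : ℝ) : star (-(Complex.I / (ħ : ℂ))) = -(-(Complex.I / (ħ : ℂ))) := by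
  rw [← starRingEnd_apply]
  simp [neg_div]

lemma neg_I_div_ne_zero {ħ : ℝ} (hħ : 0 < ħ) : -(Complex.I / (ħ : ℂ)) ≠ 0 := by
  simp [hħ.ne']

lemma IsEvolution.graph_eq {ħ : ℝ} {H : X →ₗ.[ℂ] X} {U : ℝ → X →L[ℂ] X}
    (h : IsEvolution ħ H U) : H.graph = generatorGraph (-(Complex.I / (ħ : ℂ))) U := by
  ext ⟨ψ, φ⟩
  exact h.generator ψ φ

lemma IsUnitaryGroup.isEvolution {ħ : ℝ} {H : X →ₗ.[ℂ] X} {U : ℝ → X →L[ℂ] X}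
    (hU : IsUnitaryGroup U) (h : H.graph = generatorGraph (-(Complex.I / (ħ : ℂ))) U) :
    IsEvolution ħ H U where
  unitary_mem := hU.unitary_mem
  map_zero := hU.map_zero
  map_add := hU.map_add
  continuous_apply := hU.continuous_apply
  generator ψ φ := by rw [h]; rfl

lemma CommutesWith.commute {ħ : ℝ} (hħ : 0 < ħ) {H : X →ₗ.[ℂ] X} {U : ℝ → X →L[ℂ] X}
    (h : IsEvolution ħ H U) {A : X →L[ℂ] X} (hA : CommutesWith A H) (t : ℝ) :
    Commute A (U t) := by
  refine h.isUnitaryGroup.intertwine h.isUnitaryGroup (neg_I_div_ne_zero hħ) (fun ψ φ => ?_) t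
  rw [← h.graph_eq]
  exact hA ψ φ

lemma CommutesWith.of_commute {ħ : ℝ} {H : X →ₗ.[ℂ] X} {U : ℝ → X →L[ℂ] X}
    (h : IsEvolution ħ H U) {A : X →L[ℂ] X} (hA : ∀ t, Commute A (U t)) : CommutesWith A H := by
  intro ψ φ hp
  rw [h.generator] at hp ⊢
  have := hp.continuousLinearMap_apply A
  simp only [map_smul] at this
  convert this using 1
  ext t
  exact (DFunLike.congr_fun (hA t).eq ψ).symm

/-- The evolution is determined by the Hamiltonian. -/
lemma IsEvolution.evolution_eq {ħ : ℝ} (hħ : 0 < ħ) {H : X →ₗ.[ℂ] X} {U : ℝ → X →L[ℂ] X}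
    (h : IsEvolution ħ H U) : evolution ħ H = U := by
  have hex : ∃ U, IsEvolution ħ H U := ⟨U, h⟩
  have h' : IsEvolution ħ H (evolution ħ H) := by
    rw [evolution, dif_pos hex]
    exact hex.choose_spec
  ext1 t
  have := h'.isUnitaryGroup.intertwine h.isUnitaryGroup (neg_I_div_ne_zero hħ) (A := 1)
    (fun ψ φ hp => by rwa [← h'.graph_eq, h.graph_eq] at hp) t
  simpa using this

/-- The resolvent `(H + i r)⁻¹` of a self-adjoint operator `H`, for real `r ≠ 0`. Its existence
follows from `‖(H + i r) ψ‖² = ‖H ψ‖² + r² ‖ψ‖²`, which makes `H + i r` injective with closed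
range, and from self-adjointness, which makes the range dense. -/
lemma IsSelfAdjoint.exists_resolvent {H : X →ₗ.[ℂ] X} (hH : IsSelfAdjoint H) {r : ℝ} (hr : r ≠ 0) :
    ∃ R : X →L[ℂ] X, (∀ χ, (R χ, χ - (Complex.I * r) • R χ) ∈ H.graph) ∧
      (∀ ψ φ, (ψ, φ) ∈ H.graph → R (φ + (Complex.I * r) • ψ) = ψ) ∧
      ∀ χ, |r| * ‖R χ‖ ≤ ‖χ‖ := by
  have hsa := (LinearPMap.isSelfAdjoint_iff_graph hH.dense_domain).1 hH
  have hnorm : ∀ ψ φ, (ψ, φ) ∈ H.graph →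
      ‖φ + (Complex.I * r) • ψ‖ ^ 2 = ‖φ‖ ^ 2 + (|r| * ‖ψ‖) ^ 2 := by
    intro ψ φ h
    have h1 : ⟪φ, ψ⟫_ℂ = ⟪ψ, φ⟫_ℂ := (hsa _).1 h _ h
    have h2 : RCLike.re ⟪φ, (Complex.I * r) • ψ⟫_ℂ = 0 := by
      have him : (⟪φ, ψ⟫_ℂ).im = 0 := by
        rw [← inner_conj_symm] at h1
        have := congrArg Complex.im h1
        rw [Complex.conj_im] at this
        have h3 : (⟪ψ, φ⟫_ℂ).im = 0 := by linarith
        rw [← inner_conj_symm, Complex.conj_im, h3, neg_zero]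
      rw [inner_smul_right]
      simp [him]
    rw [@norm_add_sq ℂ, h2, norm_smul]
    simp
  have hclosed : IsClosed (H.graph : Set (X × X)) := hH.isClosed
  have : CompleteSpace H.graph := hclosed.completeSpace_coe
  let T : H.graph →L[ℂ] X :=
    (ContinuousLinearMap.snd ℂ X X + (Complex.I * r) • ContinuousLinearMap.fst ℂ X X).comp
      H.graph.subtypeL
  have hT : ∀ p : H.graph, T p = p.1.2 + (Complex.I * r) • p.1.1 := fun p => rfl
  have hTn : ∀ p : H.graph, ‖T p‖ ^ 2 = ‖p.1.2‖ ^ 2 + (|r| * ‖p.1.1‖) ^ 2 := fun p =>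
    hnorm _ _ p.2
  have hr' : 0 < |r| := abs_pos.2 hr
  have hanti : AntilipschitzWith (Real.toNNReal (1 + |r|⁻¹)) T := by
    refine ContinuousLinearMap.antilipschitz_of_bound _ fun p => ?_
    rw [Real.coe_toNNReal _ (by positivity)]
    have h1 : ‖p.1.2‖ ≤ ‖T p‖ := by
      refine le_of_sq_le_sq ?_ (norm_nonneg _)
      rw [hTn]
      nlinarith [sq_nonneg (|r| * ‖p.1.1‖)]
    have h2 : |r| * ‖p.1.1‖ ≤ ‖T p‖ := by
      refine le_of_sq_le_sq ?_ (norm_nonneg _)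
      rw [hTn]
      nlinarith [sq_nonneg ‖p.1.2‖]
    have h3 : ‖p.1.1‖ ≤ |r|⁻¹ * ‖T p‖ := by
      rw [inv_mul_eq_div, le_div_iff₀ hr']
      linarith
    have h4 : ‖p‖ = max ‖p.1.1‖ ‖p.1.2‖ := rfl
    rw [h4, add_mul, one_mul]
    have : 0 ≤ |r|⁻¹ * ‖T p‖ := by positivity
    exact max_le (by linarith [norm_nonneg (T p)]) (by linarith)
  have hker : T.ker = ⊥ := LinearMap.ker_eq_bot.2 hanti.injective
  have hrange : T.range = ⊤ := by
    have hc : IsClosed (T.range : Set X) := by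
      rw [LinearMap.coe_range]
      exact hanti.isClosed_range T.uniformContinuous
    have : CompleteSpace T.range := hc.completeSpace_coe
    rw [← Submodule.orthogonal_eq_bot_iff, eq_bot_iff]
    intro χ hχ
    rw [Submodule.mem_orthogonal'] at hχ
    have h1 : ∀ q ∈ H.graph, ⟪χ, q.2 + (Complex.I * r) • q.1⟫_ℂ = 0 := fun q hq =>
      hχ _ ⟨⟨q, hq⟩, rfl⟩
    have h2 : (χ, (Complex.I * r) • χ) ∈ H.graph := by
      rw [hsa]
      intro q hq
      have := h1 q hq
      rw [inner_add_right, inner_smul_right] at this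
      rw [inner_smul_left, eq_neg_of_add_eq_zero_left this]
      simp
    have h3 := h1 _ h2
    simp only [← two_smul ℂ, inner_smul_right, mul_eq_zero] at h3
    have : ⟪χ, χ⟫_ℂ = 0 := by simpa [hr] using h3
    exact inner_self_eq_zero.1 this
  let e := ContinuousLinearEquiv.ofBijective T hker hrange
  have he : ∀ χ, T (e.symm χ) = χ := fun χ => e.apply_symm_apply χ
  refine ⟨(ContinuousLinearMap.fst ℂ X X).comp (H.graph.subtypeL.comp e.symm.toContinuousLinearMap),
    fun χ => ?_, fun ψ φ h => ?_, fun χ => ?_⟩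
  · have h1 := he χ
    rw [hT] at h1
    have h2 : χ - (Complex.I * r) • (e.symm χ).1.1 = (e.symm χ).1.2 := by
      rw [sub_eq_iff_eq_add, h1]
    change ((e.symm χ).1.1, χ - (Complex.I * r) • (e.symm χ).1.1) ∈ H.graph
    rw [h2]
    exact (e.symm χ).2
  · have : e.symm (φ + (Complex.I * r) • ψ) = ⟨(ψ, φ), h⟩ := by
      rw [ContinuousLinearEquiv.symm_apply_eq]
      rfl
    change (e.symm (φ + (Complex.I * r) • ψ)).1.1 = ψ
    rw [this]
  · change |r| * ‖(e.symm χ).1.1‖ ≤ ‖χ‖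
    refine le_of_sq_le_sq ?_ (norm_nonneg _)
    have := hTn (e.symm χ)
    rw [he] at this
    rw [this]
    nlinarith [sq_nonneg ‖(e.symm χ).1.2‖]

/-- Yosida approximation of a self-adjoint operator `H` by the bounded operators
`(r² / 2) ((H + i r)⁻¹ + (H - i r)⁻¹) = r² H (H² + r²)⁻¹`, where `r = n + 1`. -/
lemma IsSelfAdjoint.exists_yosida {H : X →ₗ.[ℂ] X} (hH : IsSelfAdjoint H) :
    ∃ B : ℕ → X →L[ℂ] X, (∀ n, IsSelfAdjoint (B n)) ∧ (∀ n m, Commute (B n) (B m)) ∧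
      ∀ ψ φ, (ψ, φ) ∈ H.graph → Tendsto (fun n => B n ψ) atTop (𝓝 φ) := by
  have hsa := (LinearPMap.isSelfAdjoint_iff_graph hH.dense_domain).1 hH
  have hr : ∀ n : ℕ, ((n : ℝ) + 1) ≠ 0 := fun n => by positivity
  choose R hR hR' hRn using fun n : ℕ => hH.exists_resolvent (hr n)
  choose S hS hS' hSn using fun n : ℕ => hH.exists_resolvent (neg_ne_zero.2 (hr n))
  -- resolvents commute, since one of them maps the graph of `H` to itself
  have hcomm : ∀ (r s : ℝ) (A B : X →L[ℂ] X),
      (∀ χ, (A χ, χ - (Complex.I * r) • A χ) ∈ H.graph) →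
      (∀ ψ φ, (ψ, φ) ∈ H.graph → A (φ + (Complex.I * r) • ψ) = ψ) →
      (∀ χ, (B χ, χ - (Complex.I * s) • B χ) ∈ H.graph) →
      (∀ ψ φ, (ψ, φ) ∈ H.graph → B (φ + (Complex.I * s) • ψ) = ψ) → Commute A B := by
    intro r s A B hA hA' hB hB'
    have hBH : ∀ ψ φ, (ψ, φ) ∈ H.graph → (B ψ, B φ) ∈ H.graph := by
      intro ψ φ h
      have h1 := hB ψ
      have h2 := hB' ψ φ h
      rw [_root_.map_add, map_smul] at h2
      rwa [← eq_sub_iff_add_eq.2 h2] at h1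
    ext χ
    have h1 := hA' _ _ (hBH _ _ (hA χ))
    rw [map_sub, map_smul, sub_add_cancel] at h1
    exact h1
  have hadj : ∀ n, star (R n) = S n := by
    intro n
    rw [ContinuousLinearMap.star_eq_adjoint, eq_comm, ContinuousLinearMap.eq_adjoint_iff]
    intro χ χ'
    have h := (hsa _).1 (hS n χ) _ (hR n χ')
    simp only [inner_sub_left, inner_sub_right, inner_smul_left, inner_smul_right] at h
    simp only [map_mul, Complex.conj_I, Complex.conj_ofReal] at h
    push_cast at h
    linear_combination -h
  have hRR : ∀ n m, Commute (R n) (R m) := fun n m =>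
    hcomm _ _ _ _ (hR n) (hR' n) (hR m) (hR' m)
  have hRS : ∀ n m, Commute (R n) (S m) := fun n m =>
    hcomm _ _ _ _ (hR n) (hR' n) (hS m) (hS' m)
  have hSS : ∀ n m, Commute (S n) (S m) := fun n m =>
    hcomm _ _ _ _ (hS n) (hS' n) (hS m) (hS' m)
  -- `i r (H + i r)⁻¹` converges strongly to the identity as `|r| → ∞`
  have hlim : ∀ (r : ℕ → ℝ) (A : ℕ → X →L[ℂ] X), (∀ n, r n ≠ 0) →
      Tendsto (fun n => |r n|⁻¹) atTop (𝓝 0) →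
      (∀ n ψ φ, (ψ, φ) ∈ H.graph → A n (φ + (Complex.I * r n) • ψ) = ψ) →
      (∀ n χ, |r n| * ‖A n χ‖ ≤ ‖χ‖) → ∀ ψ,
      Tendsto (fun n => (Complex.I * r n) • A n ψ) atTop (𝓝 ψ) := by
    intro r A hr hr0 hA hAn ψ
    refine tendsto_apply_of_dense (T := fun n => (Complex.I * r n) • A n) (A := 1) (C := 1)
      (fun n χ => ?_) hH.dense_domain (fun χ hχ => ?_) ψ
    · simpa [norm_smul] using hAn n χ
    · obtain ⟨φ, hφ⟩ := LinearPMap.mem_domain_iff.1 hχ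
      have h1 : ∀ n, (Complex.I * r n) • A n χ = χ - A n φ := fun n => by
        have := hA n χ φ hφ
        rw [_root_.map_add, map_smul] at this
        rw [eq_sub_iff_add_eq, add_comm, this]
      have h2 : Tendsto (fun n => A n φ) atTop (𝓝 0) := by
        refine squeeze_zero_norm (fun n => ?_) (by simpa using hr0.mul_const ‖φ‖)
        rw [inv_mul_eq_div, le_div_iff₀ (abs_pos.2 (hr n)), mul_comm]
        exact hAn n φ
      simpa [h1] using h2.const_sub χ
  have hn0 : Tendsto (fun n : ℕ => |(n : ℝ) + 1|⁻¹) atTop (𝓝 0) := by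
    have := tendsto_one_div_add_atTop_nhds_zero_nat (𝕜 := ℝ)
    refine this.congr fun n => ?_
    rw [abs_of_pos (by positivity), one_div]
  refine ⟨fun n => (((n : ℝ) + 1) ^ 2 / 2) • (R n + S n), fun n => ?_, fun n m => ?_, ?_⟩
  · rw [isSelfAdjoint_iff, star_smul, star_add, ← hadj n, star_star, add_comm (star (R n))]
    simp [hadj]
  · refine Commute.smul_right (Commute.smul_left ?_ _) _
    exact ((hRR n m).add_right (hRS n m)).add_left (((hRS m n).symm).add_right (hSS n m))
  · intro ψ φ h
    -- `(r² / 2) (H ± i r)⁻¹ ψ = ∓ (i r / 2) (ψ - (H ± i r)⁻¹ φ)` for `φ = H ψ`, and the terms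
    -- in `ψ` cancel in the sum
    have h1 := hlim (fun n => (n : ℝ) + 1) R hr hn0 hR' hRn φ
    have h2 := hlim (fun n => -((n : ℝ) + 1)) S (fun n => neg_ne_zero.2 (hr n))
      (by simpa only [abs_neg] using hn0) hS' hSn φ
    have h3 := (h1.add h2).const_smul (1 / 2 : ℂ)
    have h4 : (1 / 2 : ℂ) • (φ + φ) = φ := by rw [← two_smul ℂ φ, smul_smul]; norm_num
    rw [h4] at h3
    refine h3.congr fun n => ?_
    have e1 := hR' n ψ φ h
    have e2 := hS' n ψ φ h
    rw [_root_.map_add, map_smul, ← eq_sub_iff_add_eq] at e1 e2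
    rw [e1, e2]
    have e3 : (((n : ℝ) + 1) ^ 2 / 2) • (R n + S n) =
        ((((n : ℝ) + 1) ^ 2 / 2 : ℝ) : ℂ) • (R n + S n) :=
      (Complex.coe_smul _ _).symm
    simp only [e3]
    simp only [smul_apply, add_apply, smul_sub, smul_add, smul_smul]
    have hI : Complex.I ^ 2 = -1 := Complex.I_sq
    push_cast
    match_scalars
    · ring
    · linear_combination (-((n : ℂ) + 1) ^ 2 / 2) * hI
    · linear_combination (-((n : ℂ) + 1) ^ 2 / 2) * hI

/-- The group generated by a bounded self-adjoint operator. -/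
lemma IsSelfAdjoint.isUnitaryGroup_exp {B : X →L[ℂ] X} (hB : IsSelfAdjoint B) {c : ℂ}
    (hc : star c = -c) :
    IsUnitaryGroup (fun t : ℝ => NormedSpace.exp (t • c • B)) ∧
      ∀ ψ, (ψ, B ψ) ∈ generatorGraph c (fun t : ℝ => NormedSpace.exp (t • c • B)) := by
  let : NormedAlgebra ℚ (X →L[ℂ] X) := NormedAlgebra.restrictScalars ℚ ℂ _
  have hd : ∀ t : ℝ, HasDerivAt (fun t : ℝ => NormedSpace.exp (t • c • B))
      (NormedSpace.exp (t • c • B) * (c • B)) t := fun t => hasDerivAt_exp_smul_const (c • B) t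
  have happ : ∀ ψ t, HasDerivAt (fun t : ℝ => NormedSpace.exp (t • c • B) ψ)
      ((NormedSpace.exp (t • c • B) * (c • B)) ψ) t := fun ψ t =>
    (hd t).continuousLinearMap_apply (ContinuousLinearMap.apply ℂ X ψ)
  refine ⟨⟨fun t => ?_, by simp, fun s t => ?_, fun ψ => ?_⟩, fun ψ => ?_⟩
  · refine NormedSpace.exp_mem_unitary_of_mem_skewAdjoint ?_
    rw [skewAdjoint.mem_iff]
    simp [star_smul, hB.star_eq, hc]
  · rw [add_smul]
    exact NormedSpace.exp_add_of_commute (((Commute.refl (c • B)).smul_left s).smul_right t)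
  · exact continuous_iff_continuousAt.2 fun t => (happ ψ t).continuousAt
  · rw [mem_generatorGraph]
    simpa using happ ψ 0

/-- Stone's theorem: a self-adjoint operator generates a unitary group, namely the limit of the
groups generated by its Yosida approximations. -/
theorem IsSelfAdjoint.exists_isEvolution {H : X →ₗ.[ℂ] X} (hH : IsSelfAdjoint H) {ħ : ℝ}
    (hħ : 0 < ħ) : ∃ U, IsEvolution ħ H U := by
  obtain ⟨B, hB, hcomm, hlim⟩ := hH.exists_yosida
  have hsa := (LinearPMap.isSelfAdjoint_iff_graph hH.dense_domain).1 hH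
  set c := -(Complex.I / (ħ : ℂ)) with hcdef
  have hc : star c = -c := star_neg_I_div ħ
  have hc0 : c ≠ 0 := neg_I_div_ne_zero hħ
  let V : ℕ → ℝ → X →L[ℂ] X := fun n t => NormedSpace.exp (t • c • B n)
  have hV : ∀ n, IsUnitaryGroup (V n) := fun n => ((hB n).isUnitaryGroup_exp hc).1
  have hVg : ∀ n ψ, (ψ, B n ψ) ∈ generatorGraph c (V n) := fun n =>
    ((hB n).isUnitaryGroup_exp hc).2
  have hVB : ∀ n m t, Commute (B m) (V n t) := fun n m t =>
    (((hcomm m n).smul_right c).smul_right t).exp_right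
  -- `s ↦ V m (-s) (V n s ψ)` has a derivative of constant norm, as all the operators commute
  have hdiff : ∀ n m t ψ, ‖V n t ψ - V m t ψ‖ ≤ ‖c‖ * ‖B n ψ - B m ψ‖ * |t| := by
    intro n m t ψ
    have hd : ∀ s, HasDerivAt (fun s => V m (-s) (V n s ψ))
        (V m (-s) (V n s (c • (B n ψ - B m ψ)))) s := by
      intro s
      have h1 := (hV n).hasDerivAt (mem_generatorGraph.1 (hVg n ψ)) s
      have h2 := mem_generatorGraph.1 (hVg m (V n s ψ))
      refine ((hV m).hasDerivAt_neg_apply h1 h2).congr_deriv ?_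
      have : B m (V n s ψ) = V n s (B m ψ) := DFunLike.congr_fun (hVB n m s).eq ψ
      simp only [this, map_smul, map_sub, smul_sub]
    have hb := Convex.norm_image_sub_le_of_norm_hasDerivWithin_le
      (C := ‖c‖ * ‖B n ψ - B m ψ‖) (s := univ) (x := 0) (y := t)
      (fun s _ => (hd s).hasDerivWithinAt) (fun s _ => by
        rw [(hV m).norm_apply, (hV n).norm_apply, norm_smul]) convex_univ trivial trivial
    simp only [neg_zero, (hV m).map_zero, (hV n).map_zero, one_apply_eq_self, sub_zero,
      Real.norm_eq_abs] at hb
    rwa [← (hV m).norm_apply t, map_sub, (hV m).apply_neg_apply] at hb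
  have hcauchy : ∀ t ψ, CauchySeq fun n => V n t ψ := by
    intro t ψ
    rw [cauchySeq_iff_tendsto_dist_atTop_0]
    have := tendsto_apply_of_dense (T := fun p : ℕ × ℕ => V p.1 t - V p.2 t) (A := 0) (C := 2)
      (l := atTop) (fun p χ => by
        refine (norm_sub_le (V p.1 t χ) (V p.2 t χ)).trans ?_
        rw [(hV _).norm_apply, (hV _).norm_apply, two_mul]) hH.dense_domain (fun χ hχ => ?_) ψ
    · simpa [dist_eq_norm] using this.norm
    · obtain ⟨φ, hφ⟩ := LinearPMap.mem_domain_iff.1 hχ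
      have h1 := cauchySeq_iff_tendsto_dist_atTop_0.1 (hlim χ φ hφ).cauchySeq
      refine squeeze_zero_norm (fun p => hdiff p.1 p.2 t χ) ?_
      have := (h1.const_mul ‖c‖).mul_const |t|
      simpa [dist_eq_norm] using this
  choose u hu using fun t ψ => cauchySeq_tendsto_of_complete (hcauchy t ψ)
  let U : ℝ → X →L[ℂ] X := fun t =>
    continuousLinearMapOfTendsto (fun n => V n t) (tendsto_pi_nhds.2 (hu t))
  have hUlim : ∀ t ψ, Tendsto (fun n => V n t ψ) atTop (𝓝 (U t ψ)) := hu
  have hUn : ∀ t ψ, ‖U t ψ‖ = ‖ψ‖ := fun t ψ =>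
    tendsto_nhds_unique (hUlim t ψ).norm (by simp [(hV _).norm_apply])
  have hUlim2 : ∀ t (f : ℕ → X) ψ, Tendsto f atTop (𝓝 ψ) →
      Tendsto (fun n => V n t (f n)) atTop (𝓝 (U t ψ)) := by
    intro t f ψ hf
    have h1 : Tendsto (fun n => V n t (f n - ψ)) atTop (𝓝 0) := by
      rw [tendsto_zero_iff_norm_tendsto_zero]
      simp only [(hV _).norm_apply]
      rw [← tendsto_zero_iff_norm_tendsto_zero]
      simpa using hf.sub_const ψ
    simpa using h1.add (hUlim t ψ)
  have hcont : ∀ ψ, Continuous fun t => U t ψ := by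
    intro ψ
    refine continuous_iff_continuousAt.2 fun t => ?_
    refine tendsto_apply_of_dense (C := 1) (fun s χ => by rw [hUn, one_mul]) hH.dense_domain
      (fun χ hχ => ?_) ψ
    obtain ⟨φ, hφ⟩ := LinearPMap.mem_domain_iff.1 hχ
    have hlip : ∀ s, ‖U s χ - U t χ‖ ≤ ‖c‖ * ‖φ‖ * |s - t| := by
      intro s
      refine le_of_tendsto_of_tendsto ((hUlim s χ).sub (hUlim t χ)).norm
        (((hlim χ φ hφ).norm.const_mul ‖c‖).mul_const |s - t|) (Eventually.of_forall fun n => ?_)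
      have := Convex.norm_image_sub_le_of_norm_hasDerivWithin_le (f := fun s => V n s χ)
        (C := ‖c‖ * ‖B n χ‖) (s := univ) (x := t) (y := s)
        (fun s _ => ((hV n).hasDerivAt (mem_generatorGraph.1 (hVg n χ)) s).hasDerivWithinAt)
        (fun s _ => by rw [(hV n).norm_apply, norm_smul]) convex_univ trivial trivial
      simpa using this
    rw [tendsto_iff_norm_sub_tendsto_zero]
    refine squeeze_zero (fun _ => norm_nonneg _) hlip ?_
    have : Continuous fun s : ℝ => ‖c‖ * ‖φ‖ * |s - t| := by fun_prop
    simpa using this.tendsto t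
  have hU : IsUnitaryGroup U := by
    refine IsUnitaryGroup.of_inner ?_ (fun s t => ?_) (fun t ψ φ => ?_) hcont
    · ext ψ
      refine tendsto_nhds_unique (hUlim 0 ψ) ?_
      simp [(hV _).map_zero]
    · ext ψ
      refine tendsto_nhds_unique (hUlim (s + t) ψ) ?_
      simp only [(hV _).add_apply]
      exact hUlim2 s _ _ (hUlim t ψ)
    · refine tendsto_nhds_unique ((hUlim t ψ).inner tendsto_const_nhds) ?_
      simp only [(hV _).inner_apply_left]
      exact tendsto_const_nhds.inner (hUlim (-t) φ)
  -- the integrated differential equation passes to the limit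
  have hle : H.graph ≤ generatorGraph c U := by
    rintro ⟨ψ, φ⟩ h
    have key : ∀ t, U t ψ = ψ + ∫ s in (0 : ℝ)..t, U s (c • φ) := by
      intro t
      have h1 : ∀ n, V n t ψ - ψ = ∫ s in (0 : ℝ)..t, V n s (c • B n ψ) := by
        intro n
        rw [intervalIntegral.integral_eq_sub_of_hasDerivAt
          (fun s _ => (hV n).hasDerivAt (mem_generatorGraph.1 (hVg n ψ)) s)
          (((hV n).continuous_apply _).intervalIntegrable _ _)]
        simp [(hV n).map_zero]
      obtain ⟨C, hC⟩ := ((hlim ψ φ h).const_smul c).norm.bddAbove_range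
      have h2 : Tendsto (fun n => ∫ s in (0 : ℝ)..t, V n s (c • B n ψ)) atTop
          (𝓝 (∫ s in (0 : ℝ)..t, U s (c • φ))) := by
        refine intervalIntegral.tendsto_integral_filter_of_dominated_convergence (fun _ => C)
          (Eventually.of_forall fun n =>
            ((hV n).continuous_apply _).aestronglyMeasurable)
          (Eventually.of_forall fun n => Eventually.of_forall fun s _ => ?_) (by simp)
          (Eventually.of_forall fun s _ => hUlim2 s _ _ ((hlim ψ φ h).const_smul c))
        rw [(hV n).norm_apply]
        exact hC ⟨n, rfl⟩
      rw [← sub_eq_iff_eq_add']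
      refine tendsto_nhds_unique ((hUlim t ψ).sub_const ψ) ?_
      simpa only [h1] using h2
    rw [mem_generatorGraph]
    have hci := hU.continuous_apply (c • φ)
    have hd : HasDerivAt (fun t => ∫ s in (0 : ℝ)..t, U s (c • φ)) (U 0 (c • φ)) 0 :=
      intervalIntegral.integral_hasDerivAt_right (hci.intervalIntegrable _ _)
        hci.stronglyMeasurable.stronglyMeasurableAtFilter hci.continuousAt
    rw [hU.map_zero] at hd
    exact (hd.const_add ψ).congr_of_eventuallyEq (Eventually.of_forall key)
  -- a self-adjoint operator has no proper symmetric extension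
  refine ⟨U, hU.isEvolution (le_antisymm hle fun p hp => ?_)⟩
  rw [hsa]
  exact fun q hq => (hU.mem_generatorGraph_iff_inner hc0 hc).1 hp q (hle hq)

end Stone

/-! ### Translations and the momentum operator -/

section Translation

open Filter Topology

section Lp

variable {F : Type*} [NormedAddCommGroup F] [InnerProductSpace ℂ F]

/-- Translation `ψ ↦ ψ (· - t)` on `L²(ℝ; F)`. -/
def translation (F : Type*) [NormedAddCommGroup F] [InnerProductSpace ℂ F] (t : ℝ) :
    Lp F 2 (volume : Measure ℝ) →L[ℂ] Lp F 2 (volume : Measure ℝ) :=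
  (Lp.compMeasurePreservingₗᵢ ℂ (fun x : ℝ => x - t)
    (measurePreserving_sub_right volume t)).toContinuousLinearMap

lemma translation_apply_ae (t : ℝ) (f : Lp F 2 (volume : Measure ℝ)) :
    translation F t f =ᵐ[volume] fun x => f (x - t) :=
  Lp.coeFn_compMeasurePreserving f (measurePreserving_sub_right volume t)

lemma translation_zero : translation F 0 = 1 := by
  ext1 f
  refine Lp.ext ?_
  filter_upwards [translation_apply_ae 0 f] with x hx
  simpa using hx

lemma translation_add (s t : ℝ) : translation F (s + t) = translation F s * translation F t := by
  ext1 f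
  refine Lp.ext ?_
  have h := (measurePreserving_sub_right (volume : Measure ℝ) s).quasiMeasurePreserving.ae
    (translation_apply_ae t f)
  filter_upwards [translation_apply_ae (s + t) f, h, translation_apply_ae s (translation F t f)]
    with x h1 h2 h3
  change _ = translation F s (translation F t f) x
  rw [h1, h3, h2, sub_sub]

lemma isUnitaryGroup_translation [CompleteSpace F] : IsUnitaryGroup (translation F) := by
  refine IsUnitaryGroup.of_inner translation_zero translation_add (fun t f g => ?_) fun f => ?_
  · have h : g = translation F t (translation F (-t) g) := by
      change g = (translation F t * translation F (-t)) g
      rw [← translation_add, add_neg_cancel, translation_zero]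
      rfl
    conv_lhs => rw [h]
    exact LinearIsometry.inner_map_map (𝕜 := ℂ) (E := Lp F 2 (volume : Measure ℝ))
      (E' := Lp F 2 (volume : Measure ℝ)) (Lp.compMeasurePreservingₗᵢ ℂ (fun x : ℝ => x - t)
      (measurePreserving_sub_right volume t)) _ _
  · exact Continuous.compMeasurePreservingLp (μ := volume) (ν := volume) (p := 2)
      (g := fun t : ℝ => (⟨fun x : ℝ => x - t, by fun_prop⟩ : C(ℝ, ℝ)))
      (continuous_const (y := f))
      (ContinuousMap.continuous_of_continuous_uncurry _ (by simp; fun_prop))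
      (fun t => measurePreserving_sub_right volume t) (by norm_num)

end Lp

/-- Pairing with a continuous function of compact support is a bounded functional on `L²(ℝ)`. -/
lemma exists_clm_eq_integral {φ : ℝ → ℂ} (hc : Continuous φ) (hs : HasCompactSupport φ) :
    ∃ ℓ : Clock →L[ℂ] ℂ, ∀ f : Clock, ℓ f = ∫ x, f x * φ x := by
  have hm : MemLp (fun x => (starRingEnd ℂ) (φ x)) 2 (volume : Measure ℝ) :=
    (hc.memLp_of_hasCompactSupport hs).star
  refine ⟨innerSL ℂ hm.toLp, fun f => ?_⟩
  rw [innerSL_apply_apply, L2.inner_def]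
  refine integral_congr_ae ?_
  filter_upwards [hm.coeFn_toLp] with x hx
  rw [hx]
  simp

lemma translation_integral_mul (f : Clock) (φ : ℝ → ℂ) (t : ℝ) :
    ∫ x, translation ℂ t f x * φ x = ∫ x, f x * φ (x + t) := by
  have h1 : ∫ x, translation ℂ t f x * φ x = ∫ x, f (x - t) * φ x := by
    refine integral_congr_ae ?_
    filter_upwards [translation_apply_ae t f] with x hx
    rw [hx]
  rw [h1, ← integral_add_right_eq_self _ t]
  simp

/-- The pairing of a translated function with a test function is a convolution, so it may be
differentiated under the integral. -/
lemma hasDerivAt_translation_integral_mul (f : Clock) {φ : ℝ → ℂ} (hφ : ContDiff ℝ ∞ φ)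
    (hs : HasCompactSupport φ) (t : ℝ) :
    HasDerivAt (fun t => ∫ x, translation ℂ t f x * φ x)
      (∫ x, translation ℂ t f x * deriv φ x) t := by
  simp only [translation_integral_mul]
  have hf : MemLp (fun x => f (-x)) 2 (volume : Measure ℝ) :=
    (Lp.memLp f).comp_measurePreserving (Measure.measurePreserving_neg volume)
  have h := hs.hasDerivAt_convolution_right (ContinuousLinearMap.mul ℝ ℂ)
    (hf.locallyIntegrable (by norm_num)) (hφ.of_le (by simp)) t
  have e : ∀ (θ : ℝ → ℂ) (t : ℝ),
      convolution (fun x => f (-x)) θ (ContinuousLinearMap.mul ℝ ℂ) volume t =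
      ∫ x, f x * θ (x + t) := by
    intro θ t
    rw [convolution_def, ← integral_neg_eq_self]
    simp [add_comm t]
  have e' : ∀ θ : ℝ → ℂ, convolution (fun x => f (-x)) θ (ContinuousLinearMap.mul ℝ ℂ) volume =
      fun t => ∫ x, f x * θ (x + t) := fun θ => funext (e θ)
  rw [e', e'] at h
  exact h

/-- The momentum operator generates translations. A weak derivative is a derivative with respect
to translation in norm, because test functions separate the points of `L²(ℝ)`. -/
theorem generatorGraph_translation {ħ : ℝ} (hħ : 0 < ħ) :
    generatorGraph (-(Complex.I / (ħ : ℂ))) (translation ℂ) = momentumGraph ħ := by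
  have hħ' : (ħ : ℂ) ≠ 0 := by exact_mod_cast hħ.ne'
  have hU := isUnitaryGroup_translation (F := ℂ)
  ext ⟨f, g⟩
  constructor
  · intro h φ hφ hs
    obtain ⟨ℓ, hℓ⟩ := exists_clm_eq_integral hφ.continuous hs
    have h1 := (mem_generatorGraph.1 h).continuousLinearMap_apply ℓ
    rw [map_smul] at h1
    simp only [hℓ, smul_eq_mul] at h1
    have h2 := h1.unique (hasDerivAt_translation_integral_mul f hφ hs 0)
    simp only [translation_zero, one_apply_eq_self] at h2
    rw [← h2]
    field_simp
    rw [Complex.I_sq]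
    ring
  · intro h
    let ι := {φ : ℝ → ℂ // ContDiff ℝ ∞ φ ∧ HasCompactSupport φ}
    choose ℓ hℓ using fun φ : ι => exists_clm_eq_integral φ.2.1.continuous φ.2.2
    refine hU.hasDerivAt_of_weak (ℓ := ℓ) (fun w hw => ?_) fun φ t => ?_
    · have hloc : LocallyIntegrable (w : ℝ → ℂ) := (Lp.memLp w).locallyIntegrable (by norm_num)
      refine Lp.eq_zero_iff_ae_eq_zero.2
        (ae_eq_zero_of_integral_contDiff_smul_eq_zero hloc fun θ hθ hs => ?_)
      have h1 := hw ⟨fun x => (θ x : ℂ), Complex.ofRealCLM.contDiff.comp hθ,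
        hs.comp_left (g := fun y : ℝ => (y : ℂ)) (by simp)⟩
      rw [hℓ] at h1
      rw [← h1]
      refine integral_congr_ae (Eventually.of_forall fun x => ?_)
      simp [mul_comm]
    · rw [map_smul, map_smul]
      simp only [hℓ]
      refine (hasDerivAt_translation_integral_mul f φ.2.1 φ.2.2 t).congr_deriv ?_
      have h1 := h (fun x => φ.1 (x + t)) (φ.2.1.comp (contDiff_id.add contDiff_const))
        (φ.2.2.comp_homeomorph (Homeomorph.addRight t))
      have h2 : ∀ x, deriv (fun x => φ.1 (x + t)) x = deriv φ.1 (x + t) := fun x =>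
        deriv_comp_add_const _ _ _
      simp only [h2] at h1
      rw [translation_integral_mul, translation_integral_mul, h1, smul_eq_mul]
      field_simp
      rw [Complex.I_sq]
      ring

lemma isEvolution_translation {ħ : ℝ} (hħ : 0 < ħ) :
    IsEvolution ħ (momentum ħ) (translation ℂ) :=
  isUnitaryGroup_translation.isEvolution
    ((momentum_graph ħ).trans (generatorGraph_translation hħ).symm)

end Translation

/-! ### The joint Hilbert space of engine and clock -/

section JointSpace

open Filter Topology

lemma HasDerivAt.complex_bilinear {X Y Z : Type*} [NormedAddCommGroup X] [NormedSpace ℂ X]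
    [NormedAddCommGroup Y] [NormedSpace ℂ Y] [NormedAddCommGroup Z] [NormedSpace ℂ Z]
    (B : X →L[ℂ] Y →L[ℂ] Z) {u : ℝ → X} {f : ℝ → Y} {u' : X} {f' : Y} {t : ℝ}
    (hu : HasDerivAt u u' t) (hf : HasDerivAt f f' t) :
    HasDerivAt (fun t => B (u t) (f t)) (B u' (f t) + B (u t) f') t := by
  have h := (B.bilinearRestrictScalars ℝ).hasDerivAt_of_bilinear (fun _ => hu) (fun _ => hf)
  simpa [add_comm] using h

variable {E : Type*} [NormedAddCommGroup E] [InnerProductSpace ℂ E]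

lemma pureTensor_add_left (u v : E) (f : Clock) :
    pureTensor (u + v) f = pureTensor u f + pureTensor v f := by
  simp only [pureTensor, TensorProduct.add_tmul, UniformSpace.Completion.coe_add]

lemma pureTensor_add_right (u : E) (f g : Clock) :
    pureTensor u (f + g) = pureTensor u f + pureTensor u g := by
  simp only [pureTensor, TensorProduct.tmul_add, UniformSpace.Completion.coe_add]

lemma pureTensor_smul_left (k : ℂ) (u : E) (f : Clock) :
    pureTensor (k • u) f = k • pureTensor u f := by
  simp only [pureTensor, ← TensorProduct.smul_tmul', UniformSpace.Completion.coe_smul]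

lemma pureTensor_smul_right (k : ℂ) (u : E) (f : Clock) :
    pureTensor u (k • f) = k • pureTensor u f := by
  simp only [pureTensor, TensorProduct.tmul_smul, UniformSpace.Completion.coe_smul]

lemma inner_pureTensor (u v : E) (f g : Clock) :
    ⟪pureTensor u f, pureTensor v g⟫_ℂ = ⟪u, v⟫_ℂ * ⟪f, g⟫_ℂ := by
  simp only [pureTensor, UniformSpace.Completion.inner_coe, TensorProduct.inner_tmul]

lemma norm_pureTensor (u : E) (f : Clock) : ‖pureTensor u f‖ = ‖u‖ * ‖f‖ := by
  simp only [pureTensor, UniformSpace.Completion.norm_coe, TensorProduct.norm_tmul]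

/-- The tensor product of vectors as a bounded bilinear map. -/
def pureTensorL : E →L[ℂ] Clock →L[ℂ] Joint E :=
  LinearMap.mkContinuous₂ (LinearMap.mk₂ ℂ pureTensor pureTensor_add_left
    pureTensor_smul_left pureTensor_add_right pureTensor_smul_right) 1
    (fun u f => by simp [norm_pureTensor])

lemma pureTensorL_apply (u : E) (f : Clock) : pureTensorL u f = pureTensor u f := rfl

lemma Continuous.pureTensor {α : Type*} [TopologicalSpace α] {u : α → E} {f : α → Clock}
    (hu : Continuous u) (hf : Continuous f) : Continuous fun a => pureTensor (u a) (f a) :=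
  (pureTensorL.continuous.comp hu).clm_apply hf

/-- Product vectors span a dense subspace, also when the factors are taken from dense sets. -/
lemma dense_span_pureTensor {s : Set E} {s' : Set Clock} (hs : Dense s) (hs' : Dense s') :
    Dense (Submodule.span ℂ {p | ∃ u ∈ s, ∃ f ∈ s', p = pureTensor u f} : Set (Joint E)) := by
  set K := (Submodule.span ℂ {p | ∃ u ∈ s, ∃ f ∈ s', p = pureTensor u f}).topologicalClosure
    with hK
  have hKc : IsClosed (K : Set (Joint E)) := Submodule.isClosed_topologicalClosure _
  have h1 : ∀ u f, pureTensor u f ∈ K := by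
    intro u f
    have hc : IsClosed {p : E × Clock | pureTensor p.1 p.2 ∈ K} :=
      hKc.preimage (continuous_fst.pureTensor continuous_snd)
    refine (hs.prod hs').induction (P := fun p => pureTensor p.1 p.2 ∈ K) (fun p hp => ?_) hc (u, f)
    exact Submodule.le_topologicalClosure _ (Submodule.subset_span ⟨_, hp.1, _, hp.2, rfl⟩)
  have h2 : ∀ p : Joint E, p ∈ K := by
    intro p
    induction p using UniformSpace.Completion.induction_on with
    | hp => exact hKc
    | ih z =>
      induction z with
      | zero => exact K.zero_mem
      | add a b ha hb =>
        rw [UniformSpace.Completion.coe_add]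
        exact K.add_mem ha hb
      | tmul u f => exact h1 u f
  exact fun p => h2 p

lemma dense_span_range_pureTensor :
    Dense (Submodule.span ℂ {p : Joint E | ∃ u f, p = pureTensor u f} : Set (Joint E)) := by
  have := dense_span_pureTensor (dense_univ (X := E)) (dense_univ (X := Clock))
  simpa using this

lemma Joint.clm_ext {Y : Type*} [NormedAddCommGroup Y] [NormedSpace ℂ Y] {A B : Joint E →L[ℂ] Y}
    (h : ∀ u f, A (pureTensor u f) = B (pureTensor u f)) : A = B := by
  refine ContinuousLinearMap.ext_on dense_span_range_pureTensor ?_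
  rintro _ ⟨u, f, rfl⟩
  exact h u f

lemma tensorOp_one : tensorOp (1 : E →L[ℂ] E) 1 = 1 :=
  Joint.clm_ext fun u f => by simp [tensorOp_pureTensor]

lemma tensorOp_mul (A A' : E →L[ℂ] E) (B B' : Clock →L[ℂ] Clock) :
    tensorOp (A * A') (B * B') = tensorOp A B * tensorOp A' B' :=
  Joint.clm_ext fun u f => by simp [tensorOp_pureTensor]

lemma star_tensorOp [CompleteSpace E] (A : E →L[ℂ] E) (B : Clock →L[ℂ] Clock) :
    star (tensorOp A B) = tensorOp (star A) (star B) := by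
  refine Joint.clm_ext fun u f => ?_
  refine ext_inner_left ℂ fun p => ?_
  have : (innerSL ℂ (star (tensorOp A B) (pureTensor u f))) =
      innerSL ℂ (tensorOp (star A) (star B) (pureTensor u f)) := by
    refine Joint.clm_ext fun v g => ?_
    simp only [ContinuousLinearMap.star_eq_adjoint, innerSL_apply_apply,
      ContinuousLinearMap.adjoint_inner_left, tensorOp_pureTensor, inner_pureTensor]
  have h := DFunLike.congr_fun this p
  simp only [innerSL_apply_apply] at h
  rw [← inner_conj_symm, h, inner_conj_symm]

lemma IsUnitaryGroup.tensorOp [CompleteSpace E] {U : ℝ → E →L[ℂ] E} {V : ℝ → Clock →L[ℂ] Clock}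
    (hU : IsUnitaryGroup U) (hV : IsUnitaryGroup V) :
    IsUnitaryGroup fun t => tensorOp (U t) (V t) := by
  have hinner : ∀ t p q, ⟪_root_.tensorOp (U t) (V t) p, q⟫_ℂ =
      ⟪p, _root_.tensorOp (U (-t)) (V (-t)) q⟫_ℂ := by
    intro t p q
    rw [← hU.star_eq, ← hV.star_eq, ← star_tensorOp, ContinuousLinearMap.star_eq_adjoint,
      ContinuousLinearMap.adjoint_inner_right]
  have hadd : ∀ s t, _root_.tensorOp (U (s + t)) (V (s + t)) =
      _root_.tensorOp (U s) (V s) * _root_.tensorOp (U t) (V t) := fun s t => by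
    rw [hU.map_add, hV.map_add, tensorOp_mul]
  have h0 : _root_.tensorOp (U 0) (V 0) = 1 := by rw [hU.map_zero, hV.map_zero, tensorOp_one]
  have hnorm : ∀ t p, ‖_root_.tensorOp (U t) (V t) p‖ = ‖p‖ := by
    intro t p
    rw [@norm_eq_sqrt_re_inner ℂ, @norm_eq_sqrt_re_inner ℂ _ _ _ _ p, hinner,
      ← ContinuousLinearMap.comp_apply, ← ContinuousLinearMap.mul_def, ← hadd, neg_add_cancel, h0]
    rfl
  refine IsUnitaryGroup.of_inner h0 hadd hinner fun p => continuous_iff_continuousAt.2 fun t => ?_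
  refine tendsto_apply_of_dense (C := 1) (fun s q => by rw [hnorm, one_mul])
    dense_span_range_pureTensor (fun q hq => ?_) p
  induction hq using Submodule.span_induction with
  | mem q hq =>
    obtain ⟨u, f, rfl⟩ := hq
    simp only [tensorOp_pureTensor]
    exact ((hU.continuous_apply u).pureTensor (hV.continuous_apply f)).tendsto t
  | zero => simp
  | add q r _ _ hq hr =>
    simp only [_root_.map_add]
    exact hq.add hr
  | smul k q _ hq =>
    simp only [map_smul]
    exact hq.const_smul k

variable [CompleteSpace E]

lemma pureTensor_mem_generatorGraph {c : ℂ} {U : ℝ → E →L[ℂ] E} {V : ℝ → Clock →L[ℂ] Clock}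
    (hU : IsUnitaryGroup U) (hV : IsUnitaryGroup V) {p : E × E} {q : Clock × Clock}
    (hp : p ∈ generatorGraph c U) (hq : q ∈ generatorGraph c V) :
    (pureTensor p.1 q.1, pureTensor p.2 q.1 + pureTensor p.1 q.2) ∈
      generatorGraph c fun t => tensorOp (U t) (V t) := by
  rw [mem_generatorGraph] at hp hq ⊢
  have h := HasDerivAt.complex_bilinear pureTensorL hp hq
  simpa [tensorOp_pureTensor, pureTensorL_apply, hU.map_zero, hV.map_zero, pureTensor_smul_left,
    pureTensor_smul_right] using h

lemma norm_positionRep (p : Joint E) : ‖positionRep p‖ = ‖p‖ := by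
  induction p using UniformSpace.Completion.induction_on with
  | hp => exact isClosed_eq (by fun_prop) (by fun_prop)
  | ih z =>
    have h : positionRep (z : Joint E) = positionRepAlg z :=
      ContinuousLinearMap.extend_eq _
        (by exact UniformSpace.Completion.denseRange_coe)
        (by exact UniformSpace.Completion.isUniformInducing_coe _) z
    rw [h, UniformSpace.Completion.norm_coe]
    exact (positionRepAlg.isometryOfInner inner_positionRepAlg).norm_map z

lemma positionRep_surjective : Function.Surjective (positionRep (E := E)) := by
  have hiso : Isometry (positionRep (E := E)) :=
    AddMonoidHomClass.isometry_of_norm _ norm_positionRep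
  have hc : IsClosed (Set.range (positionRep (E := E))) := hiso.isClosedEmbedding.isClosed_range
  intro f
  refine Lp.induction (by norm_num) (motive := fun f => f ∈ Set.range (positionRep (E := E)))
    (fun u s hs hμ => ?_) ?_ hc f
  · refine ⟨pureTensor u (indicatorConstLp 2 hs hμ.ne 1), ?_⟩
    refine Lp.ext ?_
    rw [Lp.simpleFunc.coe_indicatorConst]
    filter_upwards [positionRep_pureTensor u (indicatorConstLp 2 hs hμ.ne 1),
      indicatorConstLp_coeFn (p := 2) (hs := hs) (hμs := hμ.ne) (c := (1 : ℂ)),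
      indicatorConstLp_coeFn (p := 2) (hs := hs) (hμs := hμ.ne) (c := u)] with x h1 h2 h3
    rw [h1, h2, h3]
    by_cases hx : x ∈ s <;> simp [hx]
  · rintro f g hf hg - ⟨p, hp⟩ ⟨q, hq⟩
    exact ⟨p + q, by rw [_root_.map_add, hp, hq]⟩

/-- The position representation as a unitary equivalence. -/
def positionEquiv (E : Type*) [NormedAddCommGroup E] [InnerProductSpace ℂ E] [CompleteSpace E] :
    Joint E ≃ₗᵢ[ℂ] Lp E 2 (volume : Measure ℝ) :=
  LinearIsometryEquiv.ofSurjective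
    { toLinearMap := (positionRep (E := E)).toLinearMap, norm_map' := norm_positionRep }
    positionRep_surjective

/-- The operator on `e ⊗ c` which is `T` in the position representation. -/
def fromPosition (T : Lp E 2 (volume : Measure ℝ) →L[ℂ] Lp E 2 (volume : Measure ℝ)) :
    Joint E →L[ℂ] Joint E :=
  positionRep.adjoint ∘L T ∘L positionRep

lemma positionRep_adjoint_apply (f : Lp E 2 (volume : Measure ℝ)) :
    positionRep (positionRep.adjoint f) = f := by
  obtain ⟨p, rfl⟩ := positionRep_surjective f
  congr 1
  refine ext_inner_left ℂ fun q => ?_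
  rw [ContinuousLinearMap.adjoint_inner_right]
  exact LinearIsometryEquiv.inner_map_map (positionEquiv E) q p

lemma positionRep_injective : Function.Injective (positionRep (E := E)) :=
  (positionEquiv E).injective

lemma positionRep_fromPosition (T : Lp E 2 (volume : Measure ℝ) →L[ℂ] Lp E 2 (volume : Measure ℝ))
    (p : Joint E) : positionRep (fromPosition T p) = T (positionRep p) :=
  positionRep_adjoint_apply _

lemma fromPosition_mul (S T : Lp E 2 (volume : Measure ℝ) →L[ℂ] Lp E 2 (volume : Measure ℝ)) :
    fromPosition (S * T) = fromPosition S * fromPosition T := by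
  ext1 p
  refine positionRep_injective ?_
  change _ = positionRep (fromPosition S (fromPosition T p))
  simp only [positionRep_fromPosition]
  rfl

lemma fromPosition_one : fromPosition (1 : Lp E 2 (volume : Measure ℝ) →L[ℂ] _) = 1 := by
  ext1 p
  refine positionRep_injective ?_
  rw [positionRep_fromPosition]
  rfl

lemma star_fromPosition (T : Lp E 2 (volume : Measure ℝ) →L[ℂ] Lp E 2 (volume : Measure ℝ)) :
    star (fromPosition T) = fromPosition (star T) := by
  simp only [ContinuousLinearMap.star_eq_adjoint, fromPosition, ContinuousLinearMap.adjoint_comp,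
    ContinuousLinearMap.adjoint_adjoint, ContinuousLinearMap.comp_assoc]

/-- Multiplication by an essentially bounded operator-valued function on `L²(ℝ; E)`. -/
def mulOp {Y : ℝ → E →L[ℂ] E} (hY : MemLp Y ∞ (volume : Measure ℝ)) :
    Lp E 2 (volume : Measure ℝ) →L[ℂ] Lp E 2 (volume : Measure ℝ) :=
  (ContinuousLinearMap.id ℂ (E →L[ℂ] E)).holderL volume ∞ 2 2 (hY.toLp Y)

lemma mulOp_apply_ae {Y : ℝ → E →L[ℂ] E} (hY : MemLp Y ∞ (volume : Measure ℝ))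
    (f : Lp E 2 (volume : Measure ℝ)) : mulOp hY f =ᵐ[volume] fun x => Y x (f x) := by
  have h := (ContinuousLinearMap.id ℂ (E →L[ℂ] E)).coeFn_holder (r := 2) (μ := volume)
    (hY.toLp Y) f
  filter_upwards [h, hY.coeFn_toLp] with x h1 h2
  rw [h2] at h1
  exact h1

lemma EngineInteraction.op_eq {He : E →ₗ.[ℂ] E} {S : Set ℝ} (h : EngineInteraction He S) :
    h.op = fromPosition (mulOp h.memLp) := rfl

/-- In the position representation, `A ⊗ T_t` acts as `ψ ↦ A (ψ (· - t))`. -/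
lemma positionRep_tensorOp_translation (A : E →L[ℂ] E) (t : ℝ) (p : Joint E) :
    positionRep (tensorOp A (translation ℂ t) p) =ᵐ[volume] fun x => A (positionRep p (x - t)) := by
  have h : (positionRep (E := E)) ∘L tensorOp A (translation ℂ t) =
      (A.compLpL 2 volume) ∘L translation E t ∘L positionRep := by
    refine Joint.clm_ext fun u f => Lp.ext ?_
    have hq := (measurePreserving_sub_right (volume : Measure ℝ) t).quasiMeasurePreserving.ae
      (positionRep_pureTensor u f)
    simp only [ContinuousLinearMap.comp_apply, tensorOp_pureTensor]
    filter_upwards [positionRep_pureTensor (A u) (translation ℂ t f), translation_apply_ae t f,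
      A.coeFn_compLpL (p := 2) (translation E t (positionRep (pureTensor u f))),
      translation_apply_ae t (positionRep (pureTensor u f)), hq] with x h1 h2 h3 h4 h5
    rw [h1, h2, h3, h4, h5, map_smul]
  have h' := DFunLike.congr_fun h p
  simp only [ContinuousLinearMap.comp_apply] at h'
  rw [h']
  filter_upwards [A.coeFn_compLpL (p := 2) (translation E t (positionRep p)),
    translation_apply_ae t (positionRep p)] with x h1 h2
  rw [h1, h2]

end JointSpace

/-! ### Time-ordered exponentials -/

section TimeOrdered

open Filter Topology

variable {E : Type*} [NormedAddCommGroup E] [InnerProductSpace ℂ E]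

lemma MeasureTheory.MemLp.exists_ae_norm_le {A : Type*} [NormedAddCommGroup A] {h : ℝ → A}
    (hm : MemLp h ∞ (volume : Measure ℝ)) : ∃ C, 0 ≤ C ∧ ∀ᵐ x, ‖h x‖ ≤ C := by
  refine ⟨(eLpNorm h ∞ volume).toReal, ENNReal.toReal_nonneg, ?_⟩
  have h1 := ae_le_eLpNormEssSup (f := h) (μ := (volume : Measure ℝ))
  filter_upwards [h1] with x hx
  rw [← eLpNorm_exponent_top] at hx
  have := ENNReal.toReal_mono hm.2.ne hx
  simpa using this

lemma MeasureTheory.MemLp.intervalIntegrable_of_top {A : Type*} [NormedAddCommGroup A] {h : ℝ → A}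
    (hm : MemLp h ∞ (volume : Measure ℝ)) (x y : ℝ) : IntervalIntegrable h volume x y :=
  ((hm.locallyIntegrable le_top).integrableOn_isCompact isCompact_uIcc).intervalIntegrable

lemma intervalIntegral_mul_left [CompleteSpace E] {h : ℝ → E →L[ℂ] E} {x y : ℝ}
    (hh : IntervalIntegrable h volume x y) (B : E →L[ℂ] E) :
    B * ∫ s in x..y, h s = ∫ s in x..y, B * h s :=
  ((ContinuousLinearMap.mul ℂ (E →L[ℂ] E) B).intervalIntegral_comp_comm hh).symm

lemma intervalIntegral_mul_right [CompleteSpace E] {h : ℝ → E →L[ℂ] E} {x y : ℝ}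
    (hh : IntervalIntegrable h volume x y) (B : E →L[ℂ] E) :
    (∫ s in x..y, h s) * B = ∫ s in x..y, h s * B :=
  (((ContinuousLinearMap.mul ℂ (E →L[ℂ] E)).flip B).intervalIntegral_comp_comm hh).symm

lemma MeasureTheory.MemLp.intervalIntegrable_mul [CompleteSpace E] {h Y : ℝ → E →L[ℂ] E}
    (hm : MemLp h ∞ (volume : Measure ℝ)) (hY : Continuous Y) (x y : ℝ) :
    IntervalIntegrable (fun s => h s * Y s) volume x y :=
  (hm.intervalIntegrable_of_top x y).mul_continuousOn hY.continuousOn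

/-- The terms of the Dyson series: the `n`-th one is the `n`-fold iterated integral of
`c ^ n • (h s₁ * ⋯ * h sₙ)` over `x ≥ s₁ ≥ ⋯ ≥ sₙ ≥ b`. -/
def dysonTerm (c : ℂ) (h : ℝ → E →L[ℂ] E) (b : ℝ) : ℕ → ℝ → E →L[ℂ] E
  | 0 => fun _ => 1
  | n + 1 => fun x => c • ∫ s in b..x, h s * dysonTerm c h b n s

variable [CompleteSpace E] {c : ℂ} {h : ℝ → E →L[ℂ] E} {b d : ℝ}

lemma continuous_dysonTerm (hm : MemLp h ∞ (volume : Measure ℝ)) (c : ℂ) (b : ℝ) (n : ℕ) :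
    Continuous (dysonTerm c h b n) := by
  induction n with
  | zero => exact continuous_const
  | succ n ih =>
    exact (intervalIntegral.continuous_primitive (fun x y => hm.intervalIntegrable_mul ih x y)
      b).const_smul c

lemma norm_dysonTerm_le {C : ℝ} (hC0 : 0 ≤ C)
    (hC : ∀ᵐ x, ‖h x‖ ≤ C) (c : ℂ) (b : ℝ) (n : ℕ) {x : ℝ} (hx : b ≤ x) :
    ‖dysonTerm c h b n x‖ ≤ (‖c‖ * C * (x - b)) ^ n / n.factorial := by
  induction n generalizing x with
  | zero =>
    simp only [dysonTerm, pow_zero, Nat.factorial_zero, Nat.cast_one, div_one]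
    exact ContinuousLinearMap.norm_id_le
  | succ n ih =>
    have h1 : ‖∫ s in b..x, h s * dysonTerm c h b n s‖ ≤
        ∫ s in b..x, C * ((‖c‖ * C * (s - b)) ^ n / n.factorial) := by
      refine intervalIntegral.norm_integral_le_of_norm_le hx ?_
        (Continuous.intervalIntegrable (by fun_prop) _ _)
      filter_upwards [hC] with s hs hsx
      exact (norm_mul_le _ _).trans (mul_le_mul hs (ih hsx.1.le) (norm_nonneg _) hC0)
    have h2 : ∫ s in b..x, C * ((‖c‖ * C * (s - b)) ^ n / n.factorial) =
        C * ((‖c‖ * C) ^ n / n.factorial * ((x - b) ^ (n + 1) / (n + 1))) := by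
      have h3 : ∀ s, C * ((‖c‖ * C * (s - b)) ^ n / n.factorial) =
          (C * ((‖c‖ * C) ^ n / n.factorial)) * (s - b) ^ n := fun s => by
        rw [mul_pow (‖c‖ * C)]; ring
      simp only [h3]
      rw [intervalIntegral.integral_const_mul,
        intervalIntegral.integral_comp_sub_right (fun s => s ^ n), integral_pow]
      simp [mul_assoc]
    calc ‖dysonTerm c h b (n + 1) x‖ = ‖c‖ * ‖∫ s in b..x, h s * dysonTerm c h b n s‖ := by
          rw [dysonTerm, norm_smul]
      _ ≤ ‖c‖ * (C * ((‖c‖ * C) ^ n / n.factorial * ((x - b) ^ (n + 1) / (n + 1)))) := by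
          gcongr
          exact h1.trans h2.le
      _ = (‖c‖ * C * (x - b)) ^ (n + 1) / (n + 1).factorial := by
          rw [Nat.factorial_succ, mul_pow (‖c‖ * C)]
          push_cast
          field_simp
          ring

lemma commute_dysonTerm (hm : MemLp h ∞ (volume : Measure ℝ)) (c : ℂ) (b : ℝ) {B : E →L[ℂ] E}
    (hB : ∀ x, Commute B (h x)) (n : ℕ) (x : ℝ) : Commute B (dysonTerm c h b n x) := by
  induction n generalizing x with
  | zero => exact Commute.one_right B
  | succ n ih =>
    have hi := hm.intervalIntegrable_mul (continuous_dysonTerm hm c b n) b x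
    have h1 : B * ∫ s in b..x, h s * dysonTerm c h b n s =
        (∫ s in b..x, h s * dysonTerm c h b n s) * B := by
      rw [intervalIntegral_mul_left hi, intervalIntegral_mul_right hi]
      refine intervalIntegral.integral_congr fun s _ => ?_
      exact ((hB s).mul_right (ih s)).eq
    exact Commute.smul_right h1 c

/-- The integral equation of the time-ordered exponential has to be checked on `[b, d]` only. -/
lemma integral_eq_of_integral_eq_on (hm : MemLp h ∞ (volume : Measure ℝ)) (hbd : b ≤ d)
    (hsupp : ∀ x, x ∉ Icc b d → h x = 0) {Y : ℝ → E →L[ℂ] E} (hYc : Continuous Y)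
    (hle : ∀ x, x ≤ b → Y x = 1) (hge : ∀ x, d ≤ x → Y x = Y d)
    (hYi : ∀ x ∈ Icc b d, Y x = 1 + c • ∫ s in b..x, h s * Y s) (x : ℝ) :
    Y x = 1 + c • ∫ s in b..x, h s * Y s := by
  rcases le_total x b with hxb | hxb
  -- to the left of `b`, the profile vanishes except possibly at the single point `b`
  · rw [hle x hxb, intervalIntegral.integral_zero_ae, smul_zero, add_zero]
    have h1 : ∀ᵐ s : ℝ, s ≠ b := by simp [ae_iff, measure_singleton]
    filter_upwards [h1] with s hsb hs
    rw [uIoc_of_ge hxb] at hs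
    rw [hsupp s fun h => hsb (le_antisymm hs.2 h.1), zero_mul]
  · rcases le_total x d with hxd | hxd
    · exact hYi x ⟨hxb, hxd⟩
    · have hi := fun x y => hm.intervalIntegrable_mul hYc x y
      rw [hge x hxd, hYi d ⟨hbd, le_rfl⟩, ← intervalIntegral.integral_add_adjacent_intervals
        (hi b d) (hi d x), intervalIntegral.integral_zero_ae (a := d), add_zero]
      refine Eventually.of_forall fun s hs => ?_
      rw [uIoc_of_le hxd] at hs
      rw [hsupp s fun h => hs.1.not_ge h.2, zero_mul]

/-- The Dyson series: existence of the time-ordered exponential of a bounded measurable family of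
operators that is supported in `[b, d]`. -/
lemma exists_timeOrdered (hm : MemLp h ∞ (volume : Measure ℝ)) (hbd : b ≤ d)
    (hsupp : ∀ x, x ∉ Icc b d → h x = 0) (c : ℂ) :
    ∃ Y : ℝ → E →L[ℂ] E, Continuous Y ∧ (∃ K, ∀ x, ‖Y x‖ ≤ K) ∧
      (∀ x, Y x = 1 + c • ∫ s in b..x, h s * Y s) ∧ (∀ x, x ≤ b → Y x = 1) ∧
      (∀ x, d ≤ x → Y x = Y d) ∧
      ∀ B, (∀ x, Commute B (h x)) → ∀ x, Commute B (Y x) := by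
  obtain ⟨C, hC0, hC⟩ := hm.exists_ae_norm_le
  -- the sum of the series on `[b, d]`, extended by constants
  let p : ℝ → ℝ := fun x => max b (min x d)
  have hpc : Continuous p := by fun_prop
  have hp : ∀ x, p x ∈ Icc b d := fun x => ⟨le_max_left _ _, max_le hbd (min_le_right _ _)⟩
  have hp' : ∀ x ∈ Icc b d, p x = x := fun x hx => by
    simp only [p, min_eq_left hx.2, max_eq_right hx.1]
  let a : ℕ → ℝ := fun n => (‖c‖ * C * (d - b)) ^ n / n.factorial
  have ha : Summable a := Real.summable_pow_div_factorial _
  have hb : ∀ n x, ‖dysonTerm c h b n (p x)‖ ≤ a n := fun n x => by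
    refine (norm_dysonTerm_le hC0 hC c b n (hp x).1).trans ?_
    have h1 : 0 ≤ p x - b := sub_nonneg.2 (hp x).1
    have h2 := (hp x).2
    simp only [a]
    gcongr
  have hs : ∀ x, Summable fun n => dysonTerm c h b n (p x) := fun x =>
    Summable.of_norm_bounded ha (hb · x)
  let Y : ℝ → E →L[ℂ] E := fun x => ∑' n, dysonTerm c h b n (p x)
  have hYc : Continuous Y :=
    continuous_tsum (fun n => (continuous_dysonTerm hm c b n).comp hpc) ha hb
  have hYK : ∀ x, ‖Y x‖ ≤ ∑' n, a n := fun x => tsum_of_norm_bounded ha.hasSum (hb · x)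
  have hYb : Y b = 1 := by
    have h1 : p b = b := hp' b ⟨le_rfl, hbd⟩
    simp only [Y, h1]
    rw [tsum_eq_single 0 fun n hn => ?_]
    · rfl
    · obtain ⟨m, rfl⟩ := Nat.exists_eq_succ_of_ne_zero hn
      simp [dysonTerm]
  have hYi : ∀ x ∈ Icc b d, Y x = 1 + c • ∫ s in b..x, h s * Y s := by
    intro x hx
    have h1 : HasSum (fun n => ∫ s in b..x, h s * dysonTerm c h b n s)
        (∫ s in b..x, h s * Y s) := by
      refine intervalIntegral.hasSum_integral_of_dominated_convergence (fun n _ => C * a n)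
        (fun n => (hm.1.restrict).mul
          (continuous_dysonTerm hm c b n).aestronglyMeasurable) (fun n => ?_) ?_ ?_ ?_
      · filter_upwards [hC] with s hs hsx
        rw [uIoc_of_le hx.1] at hsx
        have h2 := hb n s
        rw [hp' s ⟨hsx.1.le, hsx.2.trans hx.2⟩] at h2
        exact (norm_mul_le _ _).trans (mul_le_mul hs h2 (norm_nonneg _) hC0)
      · exact Eventually.of_forall fun s _ => ha.mul_left C
      · simp
      · refine Eventually.of_forall fun s hsx => ?_
        rw [uIoc_of_le hx.1] at hsx
        have h2 := (hs s).hasSum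
        simp only [hp' s ⟨hsx.1.le, hsx.2.trans hx.2⟩] at h2
        have h3 : Y s = ∑' n, dysonTerm c h b n s := by
          simp only [Y, hp' s ⟨hsx.1.le, hsx.2.trans hx.2⟩]
        rw [h3]
        exact h2.mul_left (h s)
    have h2 : Y x = ∑' n, dysonTerm c h b n x := by simp only [Y, hp' x hx]
    have h3 : Summable fun n => dysonTerm c h b n x := by simpa only [hp' x hx] using hs x
    rw [h2, h3.tsum_eq_zero_add]
    congr 1
    exact (h1.const_smul c).tsum_eq
  have hle : ∀ x, x ≤ b → Y x = 1 := fun x hx => by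
    have h1 : p x = p b := by simp [p, hx, hbd]
    rw [← hYb]
    simp only [Y, h1]
  have hge : ∀ x, d ≤ x → Y x = Y d := fun x hx => by
    have h1 : p x = p d := by simp [p, hx]
    simp only [Y, h1]
  refine ⟨Y, hYc, ⟨_, hYK⟩, fun x => ?_, hle, hge, fun B hB x => ?_⟩
  · exact integral_eq_of_integral_eq_on hm hbd hsupp hYc hle hge hYi x
  · have h1 : ∀ n, Commute B (dysonTerm c h b n (p x)) := fun n => commute_dysonTerm hm c b hB n _
    change B * Y x = Y x * B
    simp only [Y]
    rw [← (hs x).tsum_mul_left, ← (hs x).tsum_mul_right]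
    exact tsum_congr fun n => (h1 n).eq

lemma lipschitz_of_integral_eq (hm : MemLp h ∞ (volume : Measure ℝ)) {Y : ℝ → E →L[ℂ] E}
    (hY : Continuous Y) {K : ℝ} (hK : ∀ x, ‖Y x‖ ≤ K)
    (heq : ∀ x, Y x = 1 + c • ∫ s in b..x, h s * Y s) :
    ∃ M, 0 ≤ M ∧ ∀ x y, ‖Y y - Y x‖ ≤ M * |y - x| := by
  obtain ⟨C, hC0, hC⟩ := hm.exists_ae_norm_le
  have hK0 : 0 ≤ K := (norm_nonneg _).trans (hK 0)
  refine ⟨‖c‖ * (C * K), by positivity, fun x y => ?_⟩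
  have hi := fun x y => hm.intervalIntegrable_mul hY x y
  have h1 : Y y - Y x = c • ∫ s in x..y, h s * Y s := by
    rw [heq y, heq x, ← intervalIntegral.integral_interval_sub_left (hi b y) (hi b x), smul_sub]
    abel
  rw [h1, norm_smul, mul_assoc]
  gcongr
  refine intervalIntegral.norm_integral_le_of_norm_le_const_ae ?_
  filter_upwards [hC] with s hs _
  exact (norm_mul_le _ _).trans (mul_le_mul hs (hK s) (norm_nonneg _) hC0)

/-- The time-ordered exponential of a self-adjoint family is unitary. The increments of
`x ↦ Y(x)† Y(x)` are of second order, since the first-order terms cancel, so this function is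
constant and `Y` is isometric. The set where `Y` is invertible is open and closed. -/
lemma mem_unitary_of_integral_eq (hm : MemLp h ∞ (volume : Measure ℝ))
    (hsa : ∀ x, IsSelfAdjoint (h x)) (hc : star c = -c) {Y : ℝ → E →L[ℂ] E}
    (hY : Continuous Y) {K : ℝ} (hK : ∀ x, ‖Y x‖ ≤ K)
    (heq : ∀ x, Y x = 1 + c • ∫ s in b..x, h s * Y s) (x : ℝ) : Y x ∈ unitary (E →L[ℂ] E) := by
  obtain ⟨C, hC0, hC⟩ := hm.exists_ae_norm_le
  obtain ⟨M, hM0, hM⟩ := lipschitz_of_integral_eq hm hY hK heq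
  have hK0 : 0 ≤ K := (norm_nonneg _).trans (hK 0)
  have hi := fun x y => hm.intervalIntegrable_mul hY x y
  have hh : ∀ x y, IntervalIntegrable h volume x y := hm.intervalIntegrable_of_top
  have hYb : Y b = 1 := by simp [heq b]
  have hF : ∀ x, HasDerivAt (fun x => star (Y x) * Y x) 0 x := by
    intro x
    have hbound : ∀ y, ‖star (Y y) * Y y - star (Y x) * Y x‖ ≤
        (2 * K * (‖c‖ * (C * M)) + M ^ 2) * ‖‖y - x‖ ^ 2‖ := by
      intro y
      set J := ∫ s in x..y, h s with hJ
      set ρ := c • ∫ s in x..y, h s * (Y s - Y x) with hρ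
      have hJsa : star J = J := by
        have := (starL' ℝ :
          (E →L[ℂ] E) ≃L[ℝ] (E →L[ℂ] E)).toContinuousLinearMap.intervalIntegral_comp_comm (hh x y)
        have h2 : star J = ∫ s in x..y, star (h s) := this.symm
        rw [h2, hJ]
        simp only [(hsa _).star_eq]
      -- the increment of `Y` up to a remainder `ρ` of second order
      have hΔ : Y y = Y x + c • (J * Y x) + ρ := by
        have h1 : Y y - Y x = c • ∫ s in x..y, h s * Y s := by
          rw [heq y, heq x, ← intervalIntegral.integral_interval_sub_left (hi b y) (hi b x),
            smul_sub]
          abel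
        have h2 : J * Y x = ∫ s in x..y, h s * Y x :=
          intervalIntegral_mul_right (hh x y) _
        have h3 : ∫ s in x..y, h s * (Y s - Y x) =
            (∫ s in x..y, h s * Y s) - ∫ s in x..y, h s * Y x := by
          simp only [mul_sub]
          exact intervalIntegral.integral_sub (hi x y)
            (hm.intervalIntegrable_mul continuous_const x y)
        rw [hρ, h3, h2, smul_sub, ← h1]
        abel
      have hρn : ‖ρ‖ ≤ ‖c‖ * (C * M) * |y - x| ^ 2 := by
        rw [hρ, norm_smul, mul_assoc]
        gcongr
        have : C * M * |y - x| ^ 2 = C * (M * |y - x|) * |y - x| := by ring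
        rw [this]
        refine intervalIntegral.norm_integral_le_of_norm_le_const_ae ?_
        filter_upwards [hC] with s hs hsx
        exact (norm_mul_le _ _).trans (mul_le_mul hs ((hM x s).trans (mul_le_mul_of_nonneg_left
          (abs_sub_left_of_mem_uIcc (uIoc_subset_uIcc hsx)) hM0)) (norm_nonneg _) hC0)
      have hexp : star (Y y) * Y y - star (Y x) * Y x =
          star ρ * Y x + star (Y x) * ρ + star (Y y - Y x) * (Y y - Y x) := by
        have h1 : star (c • (J * Y x)) * Y x + star (Y x) * (c • (J * Y x)) = 0 := by
          rw [star_smul, star_mul, hJsa, hc, smul_mul_assoc, mul_smul_comm, neg_smul, mul_assoc,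
            neg_add_cancel]
        have h2 : ρ = Y y - Y x - c • (J * Y x) := by rw [hΔ]; abel
        have h3 : star ρ = star (Y y) - star (Y x) - star (c • (J * Y x)) := by
          rw [h2, star_sub, star_sub]
        rw [h3, h2, star_sub]
        generalize star (c • (J * Y x)) = P at *
        generalize c • (J * Y x) = Q at *
        have h4 : P * Y x = -(star (Y x) * Q) := eq_neg_of_add_eq_zero_left h1
        simp only [sub_mul, mul_sub, h4]
        abel
      have hns : ∀ A : E →L[ℂ] E, ‖star A‖ = ‖A‖ := norm_star
      have e1 : ‖star ρ * Y x‖ ≤ ‖c‖ * (C * M) * |y - x| ^ 2 * K :=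
        (norm_mul_le _ _).trans (by
          rw [hns]; exact mul_le_mul hρn (hK x) (norm_nonneg _) (by positivity))
      have e2 : ‖star (Y x) * ρ‖ ≤ K * (‖c‖ * (C * M) * |y - x| ^ 2) :=
        (norm_mul_le _ _).trans (by
          rw [hns]; exact mul_le_mul (hK x) hρn (norm_nonneg _) hK0)
      have e3 : ‖star (Y y - Y x) * (Y y - Y x)‖ ≤ (M * |y - x|) * (M * |y - x|) :=
        (norm_mul_le _ _).trans (by
          rw [hns]; exact mul_le_mul (hM x y) (hM x y) (norm_nonneg _) (by positivity))
      rw [hexp, norm_pow, norm_norm, Real.norm_eq_abs]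
      refine (norm_add₃_le).trans ((add_le_add_three e1 e2 e3).trans (le_of_eq ?_))
      ring
    rw [hasDerivAt_iff_isLittleO]
    simp only [smul_zero, sub_zero]
    exact (Asymptotics.IsBigO.of_bound _ (Eventually.of_forall hbound)).trans_isLittleO
      (Asymptotics.isLittleO_pow_sub_sub x one_lt_two)
  have hiso : ∀ x, star (Y x) * Y x = 1 := by
    intro x
    have := is_const_of_deriv_eq_zero (fun t => (hF t).differentiableAt)
      (fun t => (hF t).deriv) x b
    simpa [hYb] using this
  have hiff : ∀ x, IsUnit (Y x) ↔ Y x * star (Y x) = 1 := by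
    intro x
    constructor
    · rintro ⟨u, hu⟩
      have h1 : star (Y x) = ↑u⁻¹ := by
        rw [← mul_one (star (Y x)), ← u.mul_inv, ← mul_assoc, hu, hiso, one_mul]
      rw [h1, ← hu, u.mul_inv]
    · exact fun h => ⟨⟨Y x, star (Y x), h, hiso x⟩, rfl⟩
  have hclopen : IsClopen {x | IsUnit (Y x)} := by
    refine ⟨?_, Units.isOpen.preimage hY⟩
    simp only [hiff]
    exact isClosed_eq (hY.mul (continuous_star.comp hY)) continuous_const
  have huniv := hclopen.eq_univ ⟨b, by simp [hYb]⟩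
  have hx : IsUnit (Y x) := by
    have : x ∈ {x | IsUnit (Y x)} := huniv ▸ mem_univ x
    exact this
  exact Unitary.mem_iff.2 ⟨hiso x, (hiff x).1 hx⟩

end TimeOrdered

/-! ### The evolution of engine and clock -/

section JointEvolution

open Filter Topology

section General

variable {X : Type*} [NormedAddCommGroup X] [InnerProductSpace ℂ X]

/-- The derivative at `0` as a limit of difference quotients with complex scalars. -/
lemma hasDerivAt_zero_iff_tendsto {g : ℝ → X} {v : X} : HasDerivAt g v 0 ↔
    Tendsto (fun t : ℝ => (t : ℂ)⁻¹ • (g t - g 0)) (𝓝[≠] 0) (𝓝 v) := by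
  rw [hasDerivAt_iff_tendsto_slope]
  refine tendsto_congr fun t => ?_
  rw [slope_def_module, sub_zero, ← Complex.ofReal_inv, Complex.coe_smul]

variable [CompleteSpace X]

/-- Where the curve vanishes, strong continuity of `U` suffices for the product rule. -/
lemma IsUnitaryGroup.hasDerivAt_apply_of_zero {U : ℝ → X →L[ℂ] X} (hU : IsUnitaryGroup U)
    {g : ℝ → X} {v : X} (h0 : g 0 = 0) (hg : HasDerivAt g v 0) :
    HasDerivAt (fun t => U t (g t)) v 0 := by
  rw [hasDerivAt_zero_iff_tendsto] at hg ⊢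
  have h1 := hU.tendsto_apply (tendsto_nhdsWithin_of_tendsto_nhds tendsto_id) hg
  rw [hU.map_zero] at h1
  refine h1.congr fun t => ?_
  simp [h0]

lemma IsUnitaryGroup.conj {U : ℝ → X →L[ℂ] X} (hU : IsUnitaryGroup U) {M : X →L[ℂ] X}
    (hM : M ∈ unitary (X →L[ℂ] X)) : IsUnitaryGroup fun t => M * U t * star M := by
  obtain ⟨hM1, hM2⟩ := Unitary.mem_iff.1 hM
  refine ⟨fun t => mul_mem (mul_mem hM (hU.unitary_mem t)) (Unitary.star_mem hM), ?_, fun s t => ?_,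
    fun ψ => M.continuous.comp (hU.continuous_apply (star M ψ))⟩
  · simp only [hU.map_zero, mul_one, hM2]
  · rw [hU.map_add]
    calc M * (U s * U t) * star M = M * U s * 1 * U t * star M := by simp only [mul_one, mul_assoc]
      _ = _ := by rw [← hM1]; simp only [mul_assoc]

end General

variable {E : Type*} [NormedAddCommGroup E] [InnerProductSpace ℂ E]

lemma L2_norm_sq_eq_integral (f : Lp E 2 (volume : Measure ℝ)) : ‖f‖ ^ 2 = ∫ x, ‖f x‖ ^ 2 := by
  have h : ((‖f‖ ^ 2 : ℝ) : ℂ) = ((∫ x, ‖f x‖ ^ 2 : ℝ) : ℂ) := by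
    rw [← integral_complex_ofReal]
    have h1 := inner_self_eq_norm_sq_to_K (𝕜 := ℂ) f
    rw [L2.inner_def] at h1
    simp only [inner_self_eq_norm_sq_to_K] at h1
    push_cast
    exact h1.symm
  exact_mod_cast h

/-- Dominated convergence in `L²(ℝ; E)`. -/
lemma tendsto_L2_of_dominated {α : Type*} {l : Filter α} [l.IsCountablyGenerated]
    {F : α → Lp E 2 (volume : Measure ℝ)} {G : Lp E 2 (volume : Measure ℝ)} {φ : α → ℝ → E}
    {γ : ℝ → E} {g : ℝ → ℝ} (hF : ∀ᶠ a in l, F a =ᵐ[volume] φ a) (hG : G =ᵐ[volume] γ)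
    (hg : Integrable (fun x => g x ^ 2)) (hb : ∀ᶠ a in l, ∀ᵐ x, ‖φ a x - γ x‖ ≤ g x)
    (hlim : ∀ᵐ x, Tendsto (fun a => φ a x) l (𝓝 (γ x))) : Tendsto F l (𝓝 G) := by
  rw [tendsto_iff_norm_sub_tendsto_zero]
  have h1 : ∀ᶠ a in l, ∫ x, ‖(F a - G) x‖ ^ 2 = ‖F a - G‖ ^ 2 :=
    Eventually.of_forall fun a => (L2_norm_sq_eq_integral _).symm
  have hae : ∀ᶠ a in l, ∀ᵐ x, (F a - G) x = φ a x - γ x := by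
    filter_upwards [hF] with a ha
    filter_upwards [ha, hG, Lp.coeFn_sub (F a) G] with x h1 h2 h3
    rw [h3, Pi.sub_apply, h1, h2]
  have h2 : Tendsto (fun a => ∫ x, ‖(F a - G) x‖ ^ 2) l (𝓝 (∫ _ : ℝ, (0 : ℝ))) := by
    have h3 : Tendsto (fun a => ∫ x, ‖φ a x - γ x‖ ^ 2) l (𝓝 (∫ _ : ℝ, (0 : ℝ))) := by
      refine tendsto_integral_filter_of_dominated_convergence (fun x => g x ^ 2) ?_ ?_ hg ?_
      · filter_upwards [hae] with a ha
        have h4 : AEStronglyMeasurable (fun x => ‖(F a - G) x‖ ^ 2) volume :=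
          ((Lp.aestronglyMeasurable (F a - G)).norm.pow 2)
        refine h4.congr ?_
        filter_upwards [ha] with x hx
        rw [hx]
      · filter_upwards [hb] with a ha
        filter_upwards [ha] with x hx
        rw [Real.norm_of_nonneg (by positivity)]
        gcongr
      · filter_upwards [hlim] with x hx
        have := ((hx.sub_const (γ x)).norm).pow 2
        simpa using this
    refine h3.congr' ?_
    filter_upwards [hae] with a ha
    refine integral_congr_ae ?_
    filter_upwards [ha] with x hx
    rw [hx]
  rw [integral_zero] at h2
  have h3 : Tendsto (fun a => ‖F a - G‖ ^ 2) l (𝓝 0) := h2.congr' h1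
  have h4 := (Real.continuous_sqrt.tendsto 0).comp h3
  simpa [Function.comp_def, Real.sqrt_sq] using h4

lemma memLp_top_of_continuous {Y : ℝ → E →L[ℂ] E} (hY : Continuous Y)
    {C : ℝ} (hC : ∀ x, ‖Y x‖ ≤ C) : MemLp Y ∞ (volume : Measure ℝ) :=
  memLp_top_of_bound hY.aestronglyMeasurable C (Eventually.of_forall hC)

variable [CompleteSpace E]

lemma mulOp_mul_eq_one {Y Z : ℝ → E →L[ℂ] E} (hY : MemLp Y ∞ (volume : Measure ℝ))
    (hZ : MemLp Z ∞ (volume : Measure ℝ)) (h : ∀ x, Y x * Z x = 1) : mulOp hY * mulOp hZ = 1 := by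
  ext1 f
  refine Lp.ext ?_
  filter_upwards [mulOp_apply_ae hY (mulOp hZ f), mulOp_apply_ae hZ f] with x h1 h2
  change mulOp hY (mulOp hZ f) x = f x
  rw [h1, h2]
  exact DFunLike.congr_fun (h x) (f x)

lemma star_mulOp {Y : ℝ → E →L[ℂ] E} (hY : MemLp Y ∞ (volume : Measure ℝ))
    (hY' : MemLp (fun x => star (Y x)) ∞ (volume : Measure ℝ)) : star (mulOp hY) = mulOp hY' := by
  rw [ContinuousLinearMap.star_eq_adjoint, eq_comm, ContinuousLinearMap.eq_adjoint_iff]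
  intro f g
  rw [L2.inner_def, L2.inner_def]
  refine integral_congr_ae ?_
  filter_upwards [mulOp_apply_ae hY' f, mulOp_apply_ae hY g] with x h1 h2
  rw [h1, h2, ContinuousLinearMap.star_eq_adjoint, ContinuousLinearMap.adjoint_inner_left]

lemma norm_le_one_of_mem_unitary {A : E →L[ℂ] E} (hA : A ∈ unitary (E →L[ℂ] E)) : ‖A‖ ≤ 1 := by
  refine A.opNorm_le_bound zero_le_one fun ψ => ?_
  rw [one_mul, @norm_eq_sqrt_re_inner ℂ, @norm_eq_sqrt_re_inner ℂ _ _ _ _ ψ,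
    ← ContinuousLinearMap.adjoint_inner_right, ← ContinuousLinearMap.star_eq_adjoint,
    ← ContinuousLinearMap.comp_apply, ← ContinuousLinearMap.mul_def, (Unitary.mem_iff.1 hA).1]
  rfl

section Dressed

variable {Y : ℝ → E →L[ℂ] E} (hYm : MemLp Y ∞ (volume : Measure ℝ))
  (hYu : ∀ x, Y x ∈ unitary (E →L[ℂ] E)) {U : ℝ → E →L[ℂ] E} (hU : IsUnitaryGroup U)

/-- The evolution `Y (U t ⊗ T_t) Y†` of the joint system, where `Y` acts by multiplication in the
position representation and `T_t` is translation. -/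
def dressedEvolution {Y : ℝ → E →L[ℂ] E} (hYm : MemLp Y ∞ (volume : Measure ℝ))
    (U : ℝ → E →L[ℂ] E) (t : ℝ) : Joint E →L[ℂ] Joint E :=
  fromPosition (mulOp hYm) * tensorOp (U t) (translation ℂ t) * star (fromPosition (mulOp hYm))

include hYu in
lemma fromPosition_mulOp_mem_unitary :
    fromPosition (mulOp hYm) ∈ unitary (Joint E →L[ℂ] Joint E) := by
  have h' : MemLp (fun x => star (Y x)) ∞ (volume : Measure ℝ) := hYm.star
  rw [Unitary.mem_iff, star_fromPosition, star_mulOp hYm h', ← fromPosition_mul, ← fromPosition_mul,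
    mulOp_mul_eq_one h' hYm fun x => (Unitary.mem_iff.1 (hYu x)).1,
    mulOp_mul_eq_one hYm h' fun x => (Unitary.mem_iff.1 (hYu x)).2, fromPosition_one]
  exact ⟨rfl, rfl⟩

lemma positionRep_star_mulOp (p : Joint E) :
    positionRep (star (fromPosition (mulOp hYm)) p) =ᵐ[volume]
      fun x => star (Y x) (positionRep p x) := by
  have h' : MemLp (fun x => star (Y x)) ∞ (volume : Measure ℝ) := hYm.star
  rw [star_fromPosition, star_mulOp hYm h', positionRep_fromPosition]
  exact mulOp_apply_ae h' _

include hYu hU in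
lemma isUnitaryGroup_dressedEvolution : IsUnitaryGroup (dressedEvolution hYm U) :=
  (hU.tensorOp isUnitaryGroup_translation).conj (fromPosition_mulOp_mem_unitary hYm hYu)

include hU in
/-- Relative to the free evolution, the dressed evolution is multiplication by
`Y (x + t) Y(x)†`. -/
lemma positionRep_free_dressed (hcomm : ∀ x t, Commute (Y x) (U t)) (t : ℝ) (p : Joint E) :
    positionRep (tensorOp (U (-t)) (translation ℂ (-t)) (dressedEvolution hYm U t p)) =ᵐ[volume]
      fun x => Y (x + t) (star (Y x) (positionRep p x)) := by
  set p₁ := star (fromPosition (mulOp hYm)) p with hp₁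
  set p₂ := tensorOp (U t) (translation ℂ t) p₁ with hp₂
  have h0 : dressedEvolution hYm U t p = fromPosition (mulOp hYm) p₂ := rfl
  have hq := (measurePreserving_sub_right (volume : Measure ℝ) (-t)).quasiMeasurePreserving
  have h2 := mulOp_apply_ae hYm (positionRep p₂)
  rw [← positionRep_fromPosition] at h2
  filter_upwards [positionRep_tensorOp_translation (U (-t)) (-t) (fromPosition (mulOp hYm) p₂),
    hq.ae h2, hq.ae (positionRep_tensorOp_translation (U t) t p₁), positionRep_star_mulOp hYm p]
    with x h3 h4 h5 h6
  rw [h0, h3, h4, h5]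
  simp only [sub_neg_eq_add, add_sub_cancel_right]
  rw [h6]
  have h7 : ∀ v, Y (x + t) (U t v) = U t (Y (x + t) v) := fun v =>
    DFunLike.congr_fun (hcomm (x + t) t).eq v
  rw [h7, hU.neg_apply_apply]

include hYu hU in
/-- The dressed and the free evolution differ, to first order in time, by the interaction. This
holds for all vectors, by Lebesgue's differentiation theorem for `Y' = c h Y` and dominated
convergence. -/
lemma hasDerivAt_free_dressed {h : ℝ → E →L[ℂ] E} (hm : MemLp h ∞ (volume : Measure ℝ)) {c : ℂ}
    {b : ℝ} (hYc : Continuous Y) (heq : ∀ x, Y x = 1 + c • ∫ s in b..x, h s * Y s)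
    (hcomm : ∀ x t, Commute (Y x) (U t)) (p : Joint E) :
    HasDerivAt (fun t => tensorOp (U (-t)) (translation ℂ (-t)) (dressedEvolution hYm U t p))
      (c • fromPosition (mulOp hm) p) 0 := by
  obtain ⟨M, hM0, hM⟩ := lipschitz_of_integral_eq hm hYc
    (fun x => norm_le_one_of_mem_unitary (hYu x)) heq
  obtain ⟨C, hC0, hC⟩ := hm.exists_ae_norm_le
  have hnY : ∀ x v, ‖star (Y x) v‖ ≤ ‖v‖ := fun x v => by
    have := (star (Y x)).le_of_opNorm_le (norm_le_one_of_mem_unitary (Unitary.star_mem (hYu x))) v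
    simpa using this
  set f := positionRep p with hf
  set D : ℝ → Joint E := fun t =>
    tensorOp (U (-t)) (translation ℂ (-t)) (dressedEvolution hYm U t p) with hD
  have hD0 : D 0 = p := by
    simp only [hD, neg_zero, hU.map_zero, translation_zero, tensorOp_one,
      (isUnitaryGroup_dressedEvolution hYm hYu hU).map_zero]
    rfl
  -- `Y` solves its differential equation at almost every point
  have hderiv : ∀ᵐ x, HasDerivAt Y (c • (h x * Y x)) x := by
    have hl : LocallyIntegrable (fun s => h s * Y s) volume :=
      fun x => by
        have h1 : MemLp (fun s => h s * Y s) ∞ (volume : Measure ℝ) :=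
          memLp_top_of_bound (hm.1.mul hYc.aestronglyMeasurable) C (by
            filter_upwards [hC] with s hs
            refine (norm_mul_le _ _).trans ?_
            have := mul_le_mul hs (norm_le_one_of_mem_unitary (hYu s)) (norm_nonneg _) hC0
            simpa using this)
        exact h1.locallyIntegrable le_top x
    filter_upwards [_root_.LocallyIntegrable.ae_hasDerivAt_integral hl] with x hx
    exact (((hx b).fun_const_smul c).const_add 1).congr_of_eventuallyEq
      (Eventually.of_forall heq)
  -- difference quotients are dominated because `Y` is Lipschitz
  have key : Tendsto (fun t : ℝ => (t : ℂ)⁻¹ • (positionRep (D t) - f)) (𝓝[≠] 0)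
      (𝓝 (c • mulOp hm f)) := by
    refine tendsto_L2_of_dominated
      (φ := fun t x => (t : ℂ)⁻¹ • (Y (x + t) (star (Y x) (f x)) - f x))
      (γ := fun x => c • h x (f x)) (g := fun x => (M + ‖c‖ * C) * ‖f x‖) ?_ ?_ ?_ ?_ ?_
    · refine Eventually.of_forall fun t => ?_
      filter_upwards [positionRep_free_dressed hYm hU hcomm t p,
        Lp.coeFn_smul ((t : ℂ)⁻¹) (positionRep (D t) - f), Lp.coeFn_sub (positionRep (D t)) f]
        with x h1 h2 h3
      rw [h2, Pi.smul_apply, h3, Pi.sub_apply, h1]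
    · filter_upwards [Lp.coeFn_smul c (mulOp hm f), mulOp_apply_ae hm f] with x h1 h2
      rw [h1, Pi.smul_apply, h2]
    · simp only [mul_pow]
      exact ((memLp_two_iff_integrable_sq_norm (Lp.aestronglyMeasurable f)).1
        (Lp.memLp f)).const_mul _
    · filter_upwards [self_mem_nhdsWithin] with t ht
      filter_upwards [hC] with x hx
      have ht' : 0 < |t| := abs_pos.2 ht
      have e1 : Y (x + t) (star (Y x) (f x)) - f x = (Y (x + t) - Y x) (star (Y x) (f x)) := by
        have : Y x (star (Y x) (f x)) = f x :=
          DFunLike.congr_fun (Unitary.mem_iff.1 (hYu x)).2 (f x)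
        rw [sub_apply, this]
      have e2 : ‖(Y (x + t) - Y x) (star (Y x) (f x))‖ ≤ M * |t| * ‖f x‖ := by
        refine ((Y (x + t) - Y x).le_opNorm _).trans ?_
        have := hM x (x + t)
        rw [add_sub_cancel_left] at this
        exact mul_le_mul this (hnY _ _) (norm_nonneg _) (by positivity)
      have e3 : ‖(t : ℂ)⁻¹ • (Y (x + t) (star (Y x) (f x)) - f x)‖ ≤ M * ‖f x‖ := by
        rw [e1, norm_smul, norm_inv, Complex.norm_real, Real.norm_eq_abs, inv_mul_le_iff₀ ht']
        linarith
      have e4 : ‖c • h x (f x)‖ ≤ ‖c‖ * C * ‖f x‖ := by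
        rw [norm_smul, mul_assoc]
        gcongr
        exact (h x).le_of_opNorm_le hx (f x)
      calc _ ≤ _ := norm_sub_le _ _
        _ ≤ M * ‖f x‖ + ‖c‖ * C * ‖f x‖ := add_le_add e3 e4
        _ = _ := by ring
    · filter_upwards [hderiv] with x hx
      have h0 : HasDerivAt (fun t => Y (x + t)) (c • (h x * Y x)) 0 := by
        have h' : HasDerivAt Y (c • (h x * Y x)) (x + 0) := by simpa using hx
        exact h'.comp_const_add x 0
      have h1 := h0.continuousLinearMap_apply (ContinuousLinearMap.apply ℂ E (star (Y x) (f x)))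
      rw [hasDerivAt_zero_iff_tendsto] at h1
      have h2 : Y x (star (Y x) (f x)) = f x :=
        DFunLike.congr_fun (Unitary.mem_iff.1 (hYu x)).2 (f x)
      simpa [h2] using h1
  rw [hasDerivAt_zero_iff_tendsto]
  have h1 := ((positionRep (E := E)).adjoint.continuous.tendsto _).comp key
  have hadj : ∀ q : Joint E, positionRep.adjoint (positionRep q) = q := fun q =>
    positionRep_injective (positionRep_adjoint_apply _)
  change Tendsto (fun t : ℝ => (t : ℂ)⁻¹ • (D t - D 0)) _ _
  rw [hD0]
  simp only [Function.comp_def, map_smul, map_sub, hf, hadj] at h1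
  exact h1

include hYu hU in
/-- The generator of the dressed evolution is that of the free one plus the interaction. -/
lemma mem_generatorGraph_dressed_iff {h : ℝ → E →L[ℂ] E} (hm : MemLp h ∞ (volume : Measure ℝ))
    {c : ℂ} {b : ℝ} (hYc : Continuous Y) (heq : ∀ x, Y x = 1 + c • ∫ s in b..x, h s * Y s)
    (hcomm : ∀ x t, Commute (Y x) (U t)) (p q : Joint E) :
    (p, q + fromPosition (mulOp hm) p) ∈ generatorGraph c (dressedEvolution hYm U) ↔
      (p, q) ∈ generatorGraph c fun t => tensorOp (U t) (translation ℂ t) := by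
  have hW₀ := hU.tensorOp isUnitaryGroup_translation
  have hd := hasDerivAt_free_dressed hYm hYu hU hm hYc heq hcomm p
  set D : ℝ → Joint E := fun t =>
    tensorOp (U (-t)) (translation ℂ (-t)) (dressedEvolution hYm U t p) with hD
  have hD0 : D 0 - p = 0 := by
    simp only [hD, neg_zero, hU.map_zero, translation_zero, tensorOp_one,
      (isUnitaryGroup_dressedEvolution hYm hYu hU).map_zero]
    exact sub_self p
  have h1 := hW₀.hasDerivAt_apply_of_zero hD0 (hd.sub_const p)
  have h2 : ∀ t, tensorOp (U t) (translation ℂ t) (D t - p) =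
      dressedEvolution hYm U t p - tensorOp (U t) (translation ℂ t) p := by
    intro t
    rw [map_sub]
    congr 1
    exact hW₀.apply_neg_apply t _
  simp only [h2] at h1
  rw [mem_generatorGraph, mem_generatorGraph, smul_add]
  constructor
  · intro h3
    have := h3.fun_sub h1
    simpa using this
  · intro h3
    have := h3.fun_add h1
    simpa using this

end Dressed

end JointEvolution

/-! ### Implementation of the time-ordered exponential -/

section Implementation

open Filter Topology

variable {E : Type*} [NormedAddCommGroup E] [InnerProductSpace ℂ E] [CompleteSpace E]

/-- The free Hamiltonian, on the algebraic tensor product of the domains, is essentially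
self-adjoint, and its closure generates the product of the two evolutions. -/
lemma closure_algebraicTotalGraph_zero {ħ : ℝ} (hħ : 0 < ħ) {He : E →ₗ.[ℂ] E}
    {Hc : Clock →ₗ.[ℂ] Clock} {U : ℝ → E →L[ℂ] E} {V : ℝ → Clock →L[ℂ] Clock}
    (hU : IsEvolution ħ He U) (hV : IsEvolution ħ Hc V) :
    (algebraicTotalGraph He Hc 0).topologicalClosure =
      generatorGraph (-(Complex.I / (ħ : ℂ))) fun t => tensorOp (U t) (V t) := by
  have hUg := hU.isUnitaryGroup
  have hVg := hV.isUnitaryGroup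
  have hc0 := neg_I_div_ne_zero hħ
  refine (hUg.tensorOp hVg).topologicalClosure_eq_generatorGraph hc0 (star_neg_I_div ħ) ?_ ?_ ?_
  · refine Submodule.span_le.2 ?_
    rintro _ ⟨u, f, rfl⟩
    have h1 : ((u : E), He u) ∈ generatorGraph (-(Complex.I / (ħ : ℂ))) U := by
      rw [← hU.graph_eq]
      exact He.mem_graph u
    have h2 : ((f : Clock), Hc f) ∈ generatorGraph (-(Complex.I / (ħ : ℂ))) V := by
      rw [← hV.graph_eq]
      exact Hc.mem_graph f
    simpa using pureTensor_mem_generatorGraph hUg hVg h1 h2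
  · have hdU : Dense (He.domain : Set E) := by
      refine (hUg.dense_domain hc0).mono fun u hu => ?_
      obtain ⟨φ, hφ⟩ := hu
      rw [← hU.graph_eq] at hφ
      exact LinearPMap.mem_domain_of_mem_graph hφ
    have hdV : Dense (Hc.domain : Set Clock) := by
      refine (hVg.dense_domain hc0).mono fun u hu => ?_
      obtain ⟨φ, hφ⟩ := hu
      rw [← hV.graph_eq] at hφ
      exact LinearPMap.mem_domain_of_mem_graph hφ
    refine (dense_span_pureTensor hdU hdV).mono ?_
    have hle : Submodule.span ℂ {p : Joint E | ∃ u ∈ (He.domain : Set E),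
        ∃ f ∈ (Hc.domain : Set Clock), p = pureTensor u f} ≤
        (algebraicTotalGraph He Hc 0).map (LinearMap.fst ℂ (Joint E) (Joint E)) := by
      refine Submodule.span_le.2 ?_
      rintro _ ⟨u, hu, f, hf, rfl⟩
      exact ⟨_, Submodule.subset_span ⟨⟨u, hu⟩, ⟨f, hf⟩, rfl⟩, rfl⟩
    intro p hp
    obtain ⟨⟨p', q⟩, hq, rfl⟩ := hle hp
    exact ⟨q, hq⟩
  · intro t p hp
    let S : Joint E →ₗ[ℂ] Joint E := (tensorOp (U t) (V t)).toLinearMap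
    have hle : algebraicTotalGraph He Hc 0 ≤ (algebraicTotalGraph He Hc 0).comap (S.prodMap S) := by
      refine Submodule.span_le.2 ?_
      rintro _ ⟨u, f, rfl⟩
      refine Submodule.subset_span ?_
      have h1 : (U t u, U t (He u)) ∈ He.graph := by
        rw [hU.graph_eq]
        refine hUg.apply_mem_generatorGraph (p := (_, _)) ?_ t
        rw [← hU.graph_eq]
        exact He.mem_graph u
      have h2 : (V t f, V t (Hc f)) ∈ Hc.graph := by
        rw [hV.graph_eq]
        refine hVg.apply_mem_generatorGraph (p := (_, _)) ?_ t
        rw [← hV.graph_eq]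
        exact Hc.mem_graph f
      obtain ⟨u', hu', hu''⟩ := LinearPMap.mem_graph_iff _ |>.1 h1
      obtain ⟨f', hf', hf''⟩ := LinearPMap.mem_graph_iff _ |>.1 h2
      refine ⟨u', f', ?_⟩
      simp only at hu' hu'' hf' hf''
      simp [S, hu', hu'', hf', hf'', tensorOp_pureTensor]
    exact hle hp

/-- The total Hamiltonian is self-adjoint and generates the dressed evolution. -/
lemma closure_algebraicTotalGraph {ħ : ℝ} (hħ : 0 < ħ) {He : E →ₗ.[ℂ] E}
    {U : ℝ → E →L[ℂ] E} (hU : IsEvolution ħ He U) {h Y : ℝ → E →L[ℂ] E} {b : ℝ}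
    (hm : MemLp h ∞ (volume : Measure ℝ)) (hYm : MemLp Y ∞ (volume : Measure ℝ))
    (hYu : ∀ x, Y x ∈ unitary (E →L[ℂ] E)) (hYc : Continuous Y)
    (heq : ∀ x, Y x = 1 + (-(Complex.I / (ħ : ℂ))) • ∫ s in b..x, h s * Y s)
    (hcomm : ∀ x t, Commute (Y x) (U t)) :
    (algebraicTotalGraph He (momentum ħ) (fromPosition (mulOp hm))).topologicalClosure =
      generatorGraph (-(Complex.I / (ħ : ℂ))) (dressedEvolution hYm U) := by
  have hUg := hU.isUnitaryGroup
  have hW := isUnitaryGroup_dressedEvolution hYm hYu hUg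
  have hiff := mem_generatorGraph_dressed_iff hYm hYu hUg hm hYc heq hcomm
  have h0 := closure_algebraicTotalGraph_zero hħ hU (isEvolution_translation hħ)
  set B := fromPosition (mulOp hm) with hB
  -- the shear `(p, q) ↦ (p, q + B p)` maps the free graph onto the interacting one
  let S : Joint E × Joint E →L[ℂ] Joint E × Joint E :=
    (ContinuousLinearMap.fst ℂ _ _).prod
      (ContinuousLinearMap.snd ℂ _ _ + B.comp (ContinuousLinearMap.fst ℂ _ _))
  have hS : ∀ p, S p = (p.1, p.2 + B p.1) := fun p => rfl
  refine le_antisymm ?_ ?_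
  · refine Submodule.topologicalClosure_minimal _ ?_
      (hW.isClosed_generatorGraph (neg_I_div_ne_zero hħ) (star_neg_I_div ħ))
    refine Submodule.span_le.2 ?_
    rintro _ ⟨u, f, rfl⟩
    refine (hiff _ _).2 ?_
    rw [← h0]
    refine Submodule.le_topologicalClosure _ (Submodule.subset_span ⟨u, f, ?_⟩)
    simp
  · rintro ⟨p, q⟩ hpq
    have h1 : (p, q - B p) ∈ (algebraicTotalGraph He (momentum ħ) 0).topologicalClosure := by
      rw [h0, ← hiff, sub_add_cancel]
      exact hpq
    have h2 : S (p, q - B p) = (p, q) := by rw [hS, sub_add_cancel]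
    have h3 : (algebraicTotalGraph He (momentum ħ) 0).map S.toLinearMap ≤
        algebraicTotalGraph He (momentum ħ) B := by
      rw [algebraicTotalGraph, Submodule.map_span]
      refine Submodule.span_le.2 ?_
      rintro _ ⟨_, ⟨u, f, rfl⟩, rfl⟩
      refine Submodule.subset_span ⟨u, f, ?_⟩
      change S _ = _
      rw [hS]
      simp
    rw [← h2]
    refine map_mem_closure S.continuous h1 fun r hr => ?_
    exact h3 ⟨r, hr, rfl⟩

/-- The dressing acts trivially before the interaction region `[b, d]`, and as its final value after
it: a clock state supported in `[a, b]` has crossed the region at time `t > d - a`. -/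
lemma dressedEvolution_pureTensor {Y : ℝ → E →L[ℂ] E} (hYm : MemLp Y ∞ (volume : Measure ℝ))
    {U : ℝ → E →L[ℂ] E} {a b d : ℝ} (hleft : ∀ x, x ≤ b → Y x = 1)
    (hright : ∀ x, d ≤ x → Y x = Y d) {f : Clock} (hf : ∀ᵐ x, x ∉ Icc a b → f x = 0) {t : ℝ}
    (ht : d - a < t) (u : E) :
    dressedEvolution hYm U t (pureTensor u f) = pureTensor (Y d (U t u)) (translation ℂ t f) := by
  have h1 : star (fromPosition (mulOp hYm)) (pureTensor u f) = pureTensor u f := by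
    refine positionRep_injective (Lp.ext ?_)
    filter_upwards [positionRep_star_mulOp hYm (pureTensor u f), positionRep_pureTensor u f, hf]
      with x e1 e2 e3
    rw [e1, e2]
    by_cases hx : x ∈ Icc a b
    · rw [hleft x hx.2, star_one, one_apply_eq_self]
    · rw [e3 hx, zero_smul, map_zero]
  change fromPosition (mulOp hYm)
    (tensorOp (U t) (translation ℂ t) (star (fromPosition (mulOp hYm)) (pureTensor u f))) = _
  rw [h1, tensorOp_pureTensor]
  refine positionRep_injective (Lp.ext ?_)
  rw [positionRep_fromPosition]
  have hq := (measurePreserving_sub_right (volume : Measure ℝ) t).quasiMeasurePreserving.ae hf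
  filter_upwards [mulOp_apply_ae hYm (positionRep (pureTensor (U t u) (translation ℂ t f))),
    positionRep_pureTensor (U t u) (translation ℂ t f),
    positionRep_pureTensor (Y d (U t u)) (translation ℂ t f), translation_apply_ae t f, hq]
    with x e1 e2 e3 e4 e5
  rw [e1, e2, e3, e4, map_smul]
  by_cases hx : x - t ∈ Icc a b
  · rw [hright x (by linarith [hx.1])]
  · rw [e5 hx, zero_smul, zero_smul]

/-- Operators which agree on the range of a state `R` transform it in the same way. -/
lemma conj_eq_of_mul_eq {X : Type*} [NormedAddCommGroup X] [InnerProductSpace ℂ X] [CompleteSpace X]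
    {R W A : X →L[ℂ] X} (hR : star R = R) (h : W * R = A * R) :
    W * R * star W = A * R * star A := by
  have h2 : star R * star W = star R * star A := by rw [← star_mul, ← star_mul, h]
  rw [hR] at h2
  rw [h, mul_assoc, h2, mul_assoc]

/-- An interaction profile implements the final value of the solution `Y` of the integral equation of
its time-ordered exponential. -/
theorem exactlyImplements_of_integral_eq {ħ : ℝ} (hħ : 0 < ħ) {He : E →ₗ.[ℂ] E}
    {U : ℝ → E →L[ℂ] E} (hU : IsEvolution ħ He U) {a b d : ℝ}
    (h : EngineInteraction He (Icc b d)) {Y : ℝ → E →L[ℂ] E}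
    (hYu : ∀ x, Y x ∈ unitary (E →L[ℂ] E)) (hYc : Continuous Y)
    (heq : ∀ x, Y x = 1 + (-(Complex.I / (ħ : ℂ))) • ∫ s in b..x, h.toFun s * Y s)
    (hleft : ∀ x, x ≤ b → Y x = 1) (hright : ∀ x, d ≤ x → Y x = Y d)
    (hcomm : ∀ x t, Commute (Y x) (U t)) :
    ExactlyImplements ħ He h.op (Icc a b) (d - a) (Y d) := by
  have hYm := memLp_top_of_continuous hYc fun x => norm_le_one_of_mem_unitary (hYu x)
  have hUg := hU.isUnitaryGroup
  have hW := isUnitaryGroup_dressedEvolution hYm hYu hUg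
  have hc0 := neg_I_div_ne_zero hħ
  have hT := isEvolution_translation hħ
  set c := -(Complex.I / (ħ : ℂ)) with hc
  have hgraph := toLinearPMap_generatorGraph_graph hc0 (dressedEvolution hYm U)
  have hev : IsEvolution ħ (generatorGraph c (dressedEvolution hYm U)).toLinearPMap
    (dressedEvolution hYm U) := hW.isEvolution hgraph
  refine ⟨(generatorGraph c (dressedEvolution hYm U)).toLinearPMap, ?_, ?_, ?_, ?_⟩
  · rw [IsTotalHamiltonian, hgraph, h.op_eq]
    exact (closure_algebraicTotalGraph hħ hU h.memLp hYm hYu hYc heq hcomm).symm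
  · rw [LinearPMap.isSelfAdjoint_iff_graph, hgraph]
    · exact fun p => hW.mem_generatorGraph_iff_inner hc0 (star_neg_I_div ħ)
    · refine (hW.dense_domain hc0).mono fun p hp => ?_
      obtain ⟨q, hq⟩ := hp
      rw [← hgraph] at hq
      exact LinearPMap.mem_domain_of_mem_graph hq
  · rwa [hev.evolution_eq hħ]
  · intro ρe ρc hρe hρc hsupp t ht
    rw [hev.evolution_eq hħ, hU.evolution_eq hħ, hT.evolution_eq hħ]
    set R := tensorOp ρe ρc with hR
    set A := tensorOp (U t * Y d) (translation ℂ t) with hA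
    set W := dressedEvolution hYm U t with hWdef
    have h1 : W * R = A * R := by
      refine Joint.clm_ext fun u f => ?_
      change W (R (pureTensor u f)) = A (R (pureTensor u f))
      rw [hR, tensorOp_pureTensor, hA, tensorOp_pureTensor,
        dressedEvolution_pureTensor hYm hleft hright (hsupp f) ht]
      congr 1
      exact DFunLike.congr_fun (hcomm d t).eq (ρe u)
    have hRs : star R = R := by
      rw [hR, star_tensorOp, hρe.1.isSelfAdjoint.star_eq, hρc.1.isSelfAdjoint.star_eq]
    rw [conj_eq_of_mul_eq hRs h1, hA, hR, star_tensorOp, ← tensorOp_mul, ← tensorOp_mul, star_mul]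
    simp only [mul_assoc]

end Implementation

/-! ### Logarithms of unitaries -/

section Logarithm

variable {E : Type*} [NormedAddCommGroup E] [InnerProductSpace ℂ E] [CompleteSpace E]

/-- The orthogonal projection onto the kernel of a self-adjoint operator `T` commutes with
everything that commutes with `T`. -/
lemma exists_projection_ker {T : E →L[ℂ] E} (hT : IsSelfAdjoint T) :
    ∃ P : E →L[ℂ] E, IsSelfAdjoint P ∧ P * P = P ∧ T * P = 0 ∧
      (∀ A : E →L[ℂ] E, T * A = 0 → P * A = A) ∧ ∀ A : E →L[ℂ] E, Commute T A → Commute P A := by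
  have hcl : IsClosed (T.ker : Set E) := T.isClosed_ker
  have : CompleteSpace T.ker := hcl.completeSpace_coe
  let P : E →L[ℂ] E := T.ker.starProjection
  have hPsa : IsSelfAdjoint P := isSelfAdjoint_starProjection _
  have hTP : T * P = 0 := by
    ext v
    exact T.ker.starProjection_apply_mem v
  have hPA : ∀ A : E →L[ℂ] E, T * A = 0 → P * A = A := by
    intro A hA
    ext v
    exact Submodule.starProjection_eq_self_iff.2 (DFunLike.congr_fun hA v)
  refine ⟨P, hPsa, T.ker.isIdempotentElem_starProjection, hTP, hPA, fun A hA => ?_⟩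
  have key : ∀ A : E →L[ℂ] E, Commute T A → P * (A * P) = A * P := by
    intro A hA
    refine hPA _ ?_
    rw [← mul_assoc, hA.eq, mul_assoc, hTP, mul_zero]
  have h1 := key A hA
  have hA' : Commute T (star A) := by
    have := hA.star_star
    rwa [hT.star_eq] at this
  have h2 := congrArg star (key (star A) hA')
  simp only [star_mul, star_star, hPsa.star_eq] at h2
  change P * A = A * P
  rw [← h1, ← h2, mul_assoc]

/-- Operators that agree on the range of `P`, which `y` leaves invariant, have exponentials that
agree on it. -/
lemma exp_mul_eq_exp_mul {x y P : E →L[ℂ] E} (hy : Commute P y)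
    (h : x * P = y * P) : NormedSpace.exp x * P = NormedSpace.exp y * P := by
  have hpow : ∀ n : ℕ, x ^ n * P = y ^ n * P := by
    intro n
    induction n with
    | zero => simp
    | succ n ih =>
      rw [pow_succ, pow_succ, mul_assoc, mul_assoc, h, ← hy.eq, ← mul_assoc, ih, mul_assoc]
  rw [NormedSpace.exp_eq_tsum ℂ]
  simp only
  rw [← (NormedSpace.expSeries_summable' (𝕂 := ℂ) x).tsum_mul_right,
    ← (NormedSpace.expSeries_summable' (𝕂 := ℂ) y).tsum_mul_right]
  refine tsum_congr fun n => ?_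
  rw [smul_mul_assoc, smul_mul_assoc, hpow]

/-- On the unit circle, `arccos (Re z)` is the argument of `z` up to sign. -/
lemma exp_arccos_of_norm_eq_one {z : ℂ} (hz : ‖z‖ = 1) :
    Complex.exp (Complex.I * (Real.arccos z.re : ℂ)) = z.re + Complex.I * |z.im| := by
  have h1 : z.re ^ 2 + z.im ^ 2 = 1 := by
    have := Complex.sq_norm z
    rw [hz, Complex.normSq_apply] at this
    linarith
  have h2 : Real.sin (Real.arccos z.re) = |z.im| := by
    rw [Real.sin_arccos, ← Real.sqrt_sq_eq_abs]
    congr 1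
    linarith
  have h3 : Real.cos (Real.arccos z.re) = z.re :=
    Real.cos_arccos (by nlinarith [sq_nonneg z.im]) (by nlinarith [sq_nonneg z.im])
  rw [mul_comm, Complex.exp_mul_I, ← Complex.ofReal_cos, ← Complex.ofReal_sin, h2, h3]
  ring

/-- Every unitary `U` is the exponential of `i G`, where the self-adjoint operator `G` commutes with
everything that commutes with `U` and `U†`. With `B = arccos (Re U)`, one has `U = exp (i B)` where
`Im U ≥ 0` and `U = exp (-i B)` where `Im U ≤ 0`, so `G = B (2 P - 1)` with `P` the projection onto
the kernel of the negative part of `Im U`. -/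
lemma exists_selfAdjoint_exp_eq {U : E →L[ℂ] E} (hU : U ∈ unitary (E →L[ℂ] E)) :
    ∃ G : E →L[ℂ] E, IsSelfAdjoint G ∧ NormedSpace.exp (Complex.I • G) = U ∧
      ∀ V : E →L[ℂ] E, Commute U V → Commute (star U) V → Commute G V := by
  have hn : IsStarNormal U := ⟨by
    obtain ⟨h1, h2⟩ := Unitary.mem_iff.1 hU
    rw [Commute, SemiconjBy, h1, h2]⟩
  have hspec : ∀ z ∈ spectrum ℂ U, ‖z‖ = 1 := fun z hz => by
    simpa using spectrum.subset_circle_of_unitary hU hz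
  let β : ℂ → ℂ := fun z => (Real.arccos z.re : ℂ)
  let τ : ℂ → ℂ := fun z => ((max z.im 0 : ℝ) : ℂ)
  let σ : ℂ → ℂ := fun z => ((max (-z.im) 0 : ℝ) : ℂ)
  have hβ : Continuous β := Complex.continuous_ofReal.comp
    (Real.continuous_arccos.comp Complex.continuous_re)
  have hτ : Continuous τ := Complex.continuous_ofReal.comp (by fun_prop)
  have hσ : Continuous σ := Complex.continuous_ofReal.comp (by fun_prop)
  have hsa : ∀ f : ℂ → ℝ, IsSelfAdjoint (cfc (fun z => (f z : ℂ)) U) := fun f => by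
    rw [isSelfAdjoint_iff, ← cfc_star]
    simp
  set B := cfc β U with hB
  -- the positive and the negative part of the imaginary part of `U`
  set T₁ := cfc τ U with hT₁
  set T₂ := cfc σ U with hT₂
  have hBsa : IsSelfAdjoint B := hsa _
  obtain ⟨P, hPsa, hPP, hTP, hPA, hPc⟩ := exists_projection_ker (T := T₂) (hsa _)
  have hTT : T₂ * T₁ = 0 := by
    rw [hT₁, hT₂, ← cfc_mul σ τ U hσ.continuousOn hτ.continuousOn]
    have : (fun z => σ z * τ z) = fun _ => 0 := by
      ext z
      simp only [σ, τ, ← Complex.ofReal_mul]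
      rcases le_total z.im 0 with h | h
      · simp [max_eq_right h]
      · simp [h]
    rw [this, cfc_const_zero]
  have hcU : ∀ f : ℂ → ℂ, ∀ V, Commute U V → Commute (star U) V → Commute (cfc f U) V :=
    fun f V h1 h2 => h1.cfc h2 f
  have hPU : Commute P U := hPc U (hcU σ U (Commute.refl U) hn.star_comm_self)
  have hPU' : Commute P (star U) :=
    hPc _ (hcU σ _ hn.star_comm_self.symm (Commute.refl _))
  have hPB : Commute P B := (hcU β P hPU.symm hPU'.symm).symm
  have hT₁P : T₁ * P = T₁ := by
    have h1 := hPA T₁ hTT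
    rwa [← (hcU τ P hPU.symm hPU'.symm).eq] at h1
  have hexp : ∀ f : ℂ → ℂ, Continuous f → NormedSpace.exp (cfc f U) =
      cfc (fun z => Complex.exp (f z)) U := by
    intro f hf
    have h1 : IsStarNormal (cfc f U) := cfc_predicate f U
    rw [← CFC.complex_exp_eq_normedSpace_exp,
      ← cfc_comp' Complex.exp f U Complex.continuous_exp.continuousOn hf.continuousOn]
  have hIB : ∀ k : ℂ, k • B = cfc (fun z => k * β z) U := fun k =>
    (cfc_const_mul k β U hβ.continuousOn).symm
  have hUid : cfc (fun z : ℂ => z) U = U := cfc_id' ℂ U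
  have hplus : NormedSpace.exp (Complex.I • B) = U + (2 * Complex.I) • T₂ := by
    have h1 : U + (2 * Complex.I) • T₂ = cfc (fun z => z + 2 * Complex.I * σ z) U := by
      rw [cfc_add U (fun z => z) _ (by fun_prop) (by fun_prop), hUid,
        cfc_const_mul _ σ U hσ.continuousOn]
    rw [h1, hIB, hexp _ (by fun_prop)]
    refine cfc_congr fun z hz => ?_
    simp only [β, σ, exp_arccos_of_norm_eq_one (hspec z hz)]
    apply Complex.ext
    · simp
    · rcases le_total z.im 0 with h | h
      · simp [abs_of_nonpos h, h]; ring
      · simp [abs_of_nonneg h, h]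
  have hminus : NormedSpace.exp (-(Complex.I • B)) = U - (2 * Complex.I) • T₁ := by
    have h1 : U - (2 * Complex.I) • T₁ = cfc (fun z => z - 2 * Complex.I * τ z) U := by
      rw [cfc_sub (fun z => z) _ U (by fun_prop) (by fun_prop), hUid,
        cfc_const_mul _ τ U hτ.continuousOn]
    rw [h1, ← neg_smul, hIB, hexp _ (by fun_prop)]
    refine cfc_congr fun z hz => ?_
    have h2 : Complex.exp (-Complex.I * (Real.arccos z.re : ℂ)) =
        starRingEnd ℂ (z.re + Complex.I * |z.im|) := by
      rw [← exp_arccos_of_norm_eq_one (hspec z hz), ← Complex.exp_conj, map_mul, Complex.conj_I,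
        Complex.conj_ofReal]
    simp only [β, τ, h2]
    apply Complex.ext
    · simp
    · rcases le_total z.im 0 with h | h
      · simp [abs_of_nonpos h, h]
      · simp [abs_of_nonneg h, h]; ring
  have hSB : Commute (2 * P - 1) B :=
    ((Commute.ofNat_left 2 B).mul_left hPB).sub_left (Commute.one_left B)
  have hGP : Complex.I • (B * (2 * P - 1)) * P = Complex.I • B * P := by
    simp only [smul_mul_assoc, mul_assoc, sub_mul, hPP, one_mul]
    congr 2
    noncomm_ring
  have hGQ : Complex.I • (B * (2 * P - 1)) * (1 - P) = -(Complex.I • B) * (1 - P) := by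
    have h1 : (2 * P - 1) * (1 - P) = -(1 - P) := by
      have : (2 * P - 1) * (1 - P) = 2 * P - 2 * (P * P) - (1 - P) := by noncomm_ring
      rw [this, hPP, sub_self, zero_sub]
    rw [smul_mul_assoc, mul_assoc, h1, mul_neg, smul_neg, neg_mul, smul_mul_assoc]
  have hPIB : Commute P (Complex.I • B) := hPB.smul_right _
  refine ⟨B * (2 * P - 1), ?_, ?_, fun V h1 h2 => ?_⟩
  · have hS : IsSelfAdjoint (2 * P - 1) := by
      rw [two_mul]
      exact (hPsa.add hPsa).sub (.one _)
    exact (hBsa.commute_iff hS).1 hSB.symm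
  · have h1 := exp_mul_eq_exp_mul hPIB hGP
    have h2 := exp_mul_eq_exp_mul ((Commute.one_left _).sub_left hPIB.neg_right
      ) hGQ
    rw [hplus, add_mul, smul_mul_assoc, hTP, smul_zero, add_zero] at h1
    rw [hminus, sub_mul, smul_mul_assoc, mul_sub T₁, hT₁P, mul_one, sub_self, smul_zero,
      sub_zero] at h2
    have h3 : ∀ A : E →L[ℂ] E, A = A * P + A * (1 - P) := fun A => by noncomm_ring
    rw [h3 (NormedSpace.exp _), h1, h2, ← h3]
  · have hBV := hcU β V h1 h2
    have hPV : Commute P V := hPc V (hcU σ V h1 h2)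
    exact hBV.mul_left (((Commute.ofNat_left 2 V).mul_left hPV).sub_left (Commute.one_left V))

end Logarithm

/-! ### Exact implementation of energy-conserving unitaries -/

section Main

variable {E : Type*} [NormedAddCommGroup E] [InnerProductSpace ℂ E] [CompleteSpace E]

/-- Every interaction profile has a time-ordered exponential, and implements it. -/
lemma EngineInteraction.exists_implements {ħ : ℝ} (hħ : 0 < ħ) {He : E →ₗ.[ℂ] E}
    {U : ℝ → E →L[ℂ] E} (hU : IsEvolution ħ He U) {b d : ℝ} (hbd : b ≤ d) (a : ℝ)
    (h : EngineInteraction He (Icc b d)) :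
    ∃ W ∈ unitary (E →L[ℂ] E), CommutesWith W He ∧ IsTimeOrderedExp ħ h.toFun b d W ∧
      ExactlyImplements ħ He h.op (Icc a b) (d - a) W := by
  obtain ⟨Y, hYc, ⟨M, hM⟩, heq, hleft, hright, hB⟩ :=
    exists_timeOrdered h.memLp hbd h.support (-(Complex.I / (ħ : ℂ)))
  have hYu := mem_unitary_of_integral_eq h.memLp h.selfAdjoint (star_neg_I_div ħ) hYc hM heq
  have hcomm : ∀ x t, Commute (Y x) (U t) := fun x t =>
    (hB (U t) (fun s => ((h.commutes s).commute hħ hU t).symm) x).symm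
  refine ⟨Y d, hYu d, CommutesWith.of_commute hU (hcomm d), ⟨Y, hYc.continuousOn, fun x _ => ?_,
    rfl⟩, exactlyImplements_of_integral_eq hħ hU h hYu hYc heq hleft hright hcomm⟩
  rw [heq x, neg_smul, sub_eq_add_neg]

/-- If `W = exp (i G)`, then the constant profile `-(ħ / (d - b)) G` on `[b, d]` has the
time-ordered exponential `W`, because `Y x = exp (i ((x - b) / (d - b)) G)` solves its integral
equation. -/
lemma exists_engineInteraction {ħ : ℝ} (hħ : 0 < ħ) {He : E →ₗ.[ℂ] E}
    {U : ℝ → E →L[ℂ] E} (hU : IsEvolution ħ He U) {b d : ℝ} (hbd : b < d) (a : ℝ)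
    {W : E →L[ℂ] E} (hW : W ∈ unitary (E →L[ℂ] E)) (hWc : CommutesWith W He) :
    ∃ h : EngineInteraction He (Icc b d), IsTimeOrderedExp ħ h.toFun b d W ∧
      ExactlyImplements ħ He h.op (Icc a b) (d - a) W := by
  have hL : 0 < d - b := sub_pos.2 hbd
  obtain ⟨G, hG, hexp, hGc⟩ := exists_selfAdjoint_exp_eq hW
  have hWU : ∀ t, Commute W (U t) := hWc.commute hħ hU
  have hGU : ∀ t, Commute G (U t) := fun t => by
    refine hGc _ (hWU t) ?_
    have := (hWU (-t)).star_star
    rwa [hU.isUnitaryGroup.star_eq, neg_neg] at this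
  -- the factor makes `-(i/ħ) ∫ k G` over the interaction region equal to `i G`
  let k : ℂ := ((-(ħ / (d - b)) : ℝ) : ℂ)
  have hkG : IsSelfAdjoint (k • G) := by
    refine IsSelfAdjoint.smul ?_ hG
    rw [isSelfAdjoint_iff]
    exact Complex.conj_ofReal _
  let h : EngineInteraction He (Icc b d) :=
    { toFun := (Icc b d).indicator fun _ => k • G
      memLp := by
        refine memLp_top_of_bound ?_ ‖k • G‖ (Filter.Eventually.of_forall fun x =>
          norm_indicator_le_norm_self (fun _ => k • G) x)
        exact aestronglyMeasurable_const.indicator measurableSet_Icc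
      selfAdjoint := fun x => by
        by_cases hx : x ∈ Icc b d
        · rwa [indicator_of_mem hx]
        · rw [indicator_of_notMem hx]
          exact .zero _
      commutes := fun x => by
        refine CommutesWith.of_commute hU fun t => ?_
        by_cases hx : x ∈ Icc b d
        · rw [indicator_of_mem hx]
          exact (hGU t).smul_left k
        · rw [indicator_of_notMem hx]
          exact Commute.zero_left _
      support := fun x hx => indicator_of_notMem hx _ }
  have hV := (hG.isUnitaryGroup_exp (c := Complex.I) (by simp)).1
  let V : ℝ → E →L[ℂ] E := fun t => NormedSpace.exp (t • Complex.I • G)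
  have hVd : ∀ t, HasDerivAt V ((Complex.I • G) * V t) t := fun t =>
    let : NormedAlgebra ℚ (E →L[ℂ] E) := NormedAlgebra.restrictScalars ℚ ℂ _
    hasDerivAt_exp_smul_const' (Complex.I • G) t
  have hVc : Continuous V := continuous_iff_continuousAt.2 fun t => (hVd t).continuousAt
  -- the fraction of the interaction region to the left of `x`
  let p : ℝ → ℝ := fun x => (max b (min x d) - b) / (d - b)
  have hp : ∀ x ∈ Icc b d, p x = (x - b) / (d - b) := fun x hx => by
    simp only [p, min_eq_left hx.2, max_eq_right hx.1]
  have hYc : Continuous fun x => V (p x) := hVc.comp (by fun_prop)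
  have hYb : ∀ x, x ≤ b → V (p x) = 1 := fun x hx => by
    have : p x = 0 := by simp [p, hx]
    rw [this]
    exact hV.map_zero
  have hYd : ∀ x, d ≤ x → V (p x) = W := fun x hx => by
    have : p x = 1 := by simp [p, hx, hbd.le, hL.ne']
    rw [this, ← hexp]
    simp [V]
  have heq : ∀ x, V (p x) = 1 + (-(Complex.I / (ħ : ℂ))) • ∫ s in b..x, h.toFun s * V (p s) := by
    refine integral_eq_of_integral_eq_on h.memLp hbd.le h.support hYc hYb
      (fun x hx => by rw [hYd x hx, hYd d le_rfl]) fun x hx => ?_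
    have h1 : ∀ s, HasDerivAt (fun s => V ((s - b) / (d - b)))
        ((d - b)⁻¹ • ((Complex.I • G) * V ((s - b) / (d - b)))) s := fun s => by
      have h2 : HasDerivAt (fun s : ℝ => (s - b) / (d - b)) (d - b)⁻¹ s := by
        simpa using ((hasDerivAt_id s).sub_const b).div_const (d - b)
      exact (hVd _).scomp s h2
    have h3 : ∫ s in b..x, h.toFun s * V (p s) =
        ((ħ : ℂ) * Complex.I) •
          ∫ s in b..x, (d - b)⁻¹ • ((Complex.I • G) * V ((s - b) / (d - b))) := by
      rw [← intervalIntegral.integral_smul]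
      refine intervalIntegral.integral_congr fun s hs => ?_
      rw [uIcc_of_le hx.1] at hs
      have hs' : s ∈ Icc b d := ⟨hs.1, hs.2.trans hx.2⟩
      have h4 : h.toFun s = k • G := indicator_of_mem hs' fun _ => k • G
      simp only [h4, hp s hs', smul_mul_assoc]
      rw [← Complex.coe_smul, smul_smul, smul_smul]
      congr 1
      simp only [k]
      push_cast
      linear_combination (-(ħ : ℂ) / ((d : ℂ) - b)) * Complex.I_mul_I
    have hħ' : (ħ : ℂ) ≠ 0 := by exact_mod_cast hħ.ne'
    have h5 : -(Complex.I / (ħ : ℂ)) * ((ħ : ℂ) * Complex.I) = 1 := by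
      field_simp
      simp
    rw [h3, smul_smul, h5, one_smul, intervalIntegral.integral_eq_sub_of_hasDerivAt
      (fun s _ => h1 s) ?_, hp x hx, sub_self, zero_div]
    · have : V 0 = 1 := hV.map_zero
      rw [this]
      abel
    · refine Continuous.intervalIntegrable ?_ _ _
      have : Continuous fun s => V ((s - b) / (d - b)) := hVc.comp (by fun_prop)
      exact Continuous.const_smul (g := fun s => Complex.I • G * V ((s - b) / (d - b)))
        (continuous_const.mul this) (d - b)⁻¹
  have hcomm : ∀ x t, Commute (V (p x)) (U t) := fun x t =>
    let : NormedAlgebra ℚ (E →L[ℂ] E) := NormedAlgebra.restrictScalars ℚ ℂ _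
    (((hGU t).smul_left Complex.I).smul_left (p x)).exp_left
  refine ⟨h, ⟨fun x => V (p x), hYc.continuousOn, fun x _ => ?_, hYd d le_rfl⟩, ?_⟩
  · exact (heq x).trans (by rw [neg_smul, sub_eq_add_neg])
  · have h1 := exactlyImplements_of_integral_eq (Y := fun x => V (p x)) (a := a) hħ hU h
      (fun x => hV.unitary_mem _) hYc heq hYb (fun x hx => by rw [hYd x hx, hYd d le_rfl]) hcomm
    simpa only [hYd d le_rfl] using h1

end Main

end

theorem mainTheorem1 {E : Type*} [NormedAddCommGroup E] [InnerProductSpace ℂ E] [CompleteSpace E]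
    (ħ : ℝ) (hħ : 0 < ħ) (He : E →ₗ.[ℂ] E) (hHe : IsSelfAdjoint He)
    (a K L : ℝ) (hK : 0 ≤ K) (hL : 0 < L) :
    -- every energy-conserving unitary is implemented by some interaction
    (∀ Ue ∈ unitary (E →L[ℂ] E), CommutesWith Ue He →
      ∃ h : EngineInteraction He (Icc (a + K) (a + K + L)),
        IsTimeOrderedExp ħ h.toFun (a + K) (a + K + L) Ue ∧
        ExactlyImplements ħ He h.op (Icc a (a + K)) (K + L) Ue) ∧
    -- every interaction implements its time-ordered exponential
    (∀ h : EngineInteraction He (Icc (a + K) (a + K + L)),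
      ∃ Ue ∈ unitary (E →L[ℂ] E), CommutesWith Ue He ∧
        IsTimeOrderedExp ħ h.toFun (a + K) (a + K + L) Ue ∧
        ExactlyImplements ħ He h.op (Icc a (a + K)) (K + L) Ue) ∧
    -- the free evolution of the clock is translation
    (IsEvolution ħ (momentum ħ) (evolution ħ (momentum ħ)) ∧
      ∀ (t : ℝ) (f : Clock),
        (evolution ħ (momentum ħ) t f : Clock) =ᵐ[volume] fun x => f (x - t)) := by
  obtain ⟨U, hU⟩ := hHe.exists_isEvolution hħ
  have hτ : a + K + L - a = K + L := by ring
  have hJ : a + K < a + K + L := by linarith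
  refine ⟨fun Ue hUe hc => ?_, fun h => ?_, ?_, fun t f => ?_⟩
  · rw [← hτ]
    exact exists_engineInteraction hħ hU hJ a hUe hc
  · rw [← hτ]
    exact h.exists_implements hħ hU hJ.le a
  · rw [(isEvolution_translation hħ).evolution_eq hħ]
    exact isEvolution_translation hħ
  · rw [(isEvolution_translation hħ).evolution_eq hħ]
    exact translation_apply_ae t f
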